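/- Let $G=(V,E)$ be a finite connected simple undirected graph with $n$ nodes and a distinguished node $v_1$ (the root). Every node $i$, of degree $\delta_i$, numbers its incident links arbitrarily by $1,\dots,\delta_i$; let $\alpha_i(j)$ be the index that $i$ gives to the link to its neighbour $j$. Path words are finite words over $\{\bot\}\cup\mathbb N$, where $\bot$ is the minimal character, ordered lexicographically (a proper prefix is smaller); $\oplus$ is concatenation, and $|w|_N$ consists of the $N$ rightmost characters of $w$, where $N\ge n$ is fixed. Every processor $i\in V$ has a register with the fields $path_i$, $count_i\in\mathbb Z$, $bcc_i$, which it can read and write and its neighbours can read. For neighbours $i,j$ call the link between them - a child link of $i$ (and the parent link of $j$; $i$ is the parent of $j$) if $path_j=path_i\oplus\alpha_i(j)$; - an incoming non-tree edge of $i$ (and an outgoing non-tree edge of $j$) if $path_j=path_i\oplus s$ for some word $s\neq\alpha_i(j)$. Node $j$ is an ancestor of $i$, and $i$ a descendant of $j$, if $path_j$ is a prefix of $path_i$ (in particular each node is an ancestor of itself). The 2-EDGE & 2-VERTEX CONNECTIVITY algorithm is the following. The root forever writes $path_{v_1}:=\bot$, $count_{v_1}:=0$, $bcc_{v_1}:=\bot$.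 Every other processor $i$ forever executes: (1) read $path_j$ of all neighbours $j$, one after the other, and write $path_i:=\min_j |path_j\oplus\alpha_j(i)|_N$; (2) read $path_i$, set $count:=0$, go through the neighbours $j$ in the order of the numbering and, according to the values of $path_i$ and $path_j$ that were read, add $count_j$ (which is read) to $count$ if the link is a child link of $i$, otherwise subtract $1$ if it is an incoming non-tree edge of $i$, otherwise add $1$ if it is an outgoing non-tree edge of $i$; then write $count_i:=count$; (3) read $count_i$ and $path_i$; if $count_i=0$ write $bcc_i:=path_i$, otherwise read $bcc_j$ over the parent link of $i$ and write this value to $bcc_i$. In each atomic step one processor, chosen by a scheduler, executes at most one read or one write. An execution may start in any configuration (arbitrary registers, program counters and local variables); it is fair if every processor executes infinitely many steps. A bridge is an edge, and an articulation point is a node, whose removal disconnects $G$. A bridge-connected component is the node set of a maximal connected subgraph that contains no bridge of $G$. A representative node of a bridge-connected component is a node of it that is an ancestor of all of its nodes. **Lemma.** Every fair execution of the algorithm has a suffix such that in every configuration of the suffix: 1. for every node $v$, $path_v$ is the lexicographically least word $\bot\oplus\alpha_{u_0}(u_1)\oplus\cdots\oplus\alpha_{u_{k-1}}(u_k)$ over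 all simple paths $v_1=u_0,u_1,\dots,u_k=v$; every node other than the root has exactly one parent; and every link, seen from either end, is a parent link, a child link, an outgoing non-tree edge or an incoming non-tree edge; 2. for every node $v$, $count_v$ is the number of non-tree edges that bypass the parent link of $v$, that is, that join a descendant of $v$ to an ancestor of the parent of $v$ ($count_v=0$ for the root); 3. a link between $u$ and $v$ is a bridge of $G$ if and only if $u$ is the parent of $v$ and $count_v=0$, or $v$ is the parent of $u$ and $count_u=0$; 4. a node $v\ne v_1$ is an articulation point of $G$ if and only if it has a child $u$ such that $count_u$ equals the number of incoming non-tree edges of $v$ whose other end is a descendant of $u$; the root is an articulation point of $G$ if and only if it has at least two children; 5. $bcc_u=bcc_v$ if and only if $u$ and $v$ lie in the same bridge-connected component; every bridge-connected component $S$ has exactly one representative node $r$; a node $r\in S$ is the representative node of $S$ if and only if $count_r=0$; and $S=\{v : bcc_v=path_r\}$ for the representative node $r$ of $S$. -/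

import Mathlib

namespace SelfStab

/-- Characters of path words: the minimal character `⊥` and the (positive) edge indices. -/
abbrev Label := WithBot ℕ

/-- Path words, ordered lexicographically (a proper prefix is smaller). -/
abbrev PathWord := List Label

/-- `|w|_N`: keep the `N` rightmost characters of `w`. -/
def truncate (N : ℕ) (w : PathWord) : PathWord := w.rtake N

/-- `w = p ⊕ a`. Applied to the path values of the two ends of a link, this is the test for a
tree link leading from the node with path `p` (the parent) to the node with path `w`, where `a` is
the edge index of the link at the former. -/
def IsTreeExt (p : PathWord) (a : ℕ) (w : PathWord) : Prop := w = p ++ [(a : Label)]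

/-- `∃ s, w = p ⊕ s ∧ s ≠ a`: the test for a non-tree link between the node with path `p`
(the ancestor) and the node with path `w` (the descendant). -/
def IsNonTreeExt (p : PathWord) (a : ℕ) (w : PathWord) : Prop :=
  ∃ s : PathWord, w = p ++ s ∧ s ≠ [(a : Label)]

/-! ### The network -/

section Network

variable {V : Type*} [Fintype V] [DecidableEq V]

/-- Every node orders its incident links arbitrarily. -/
abbrev PortNumbering (G : SimpleGraph V) [DecidableRel G.Adj] : Type _ :=
  ∀ i : V, Fin (G.degree i) ≃ G.neighborSet i

variable {G : SimpleGraph V} [DecidableRel G.Adj]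

/-- The neighbour of `i` over the `j`-th link of `i` (the links are counted from `0` here). -/
def PortNumbering.nbr (α : PortNumbering G) (i : V) (j : Fin (G.degree i)) : V := (α i j : V)

/-- The edge index `α_i(j) ∈ {1, …, δ_i}` of the link from `i` to its neighbour `j`
(`0` if `j` is no neighbour of `i`). -/
def PortNumbering.idx (α : PortNumbering G) (i j : V) : ℕ :=
  if h : G.Adj i j then ((α i).symm ⟨j, h⟩ : ℕ) + 1 else 0

/-! ### Processors -/

/-- The communication register of a processor. -/
structure Register where
  path : PathWord
  count : ℤ
  bcc : PathWord

/-- Program counter of the root: the next write operation. -/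
inductive RootPC where
  | writePath
  | writeCount
  | writeBcc

/-- Program counter of a non-root processor of degree `δ`. -/
inductive NodePC (δ : ℕ) where
  /-- first loop: read the path field of the `j`-th neighbour -/
  | readPath (j : Fin δ)
  /-- write the own path field -/
  | writePath
  /-- `path := read(path_i)`, `count := 0` -/
  | readOwnPath
  /-- second loop: iteration `j` of the computation of `count` -/
  | countLoop (j : Fin δ)
  /-- write the own count field -/
  | writeCount
  /-- `count := read(count_i)` -/
  | readOwnCount
  /-- `path := read(path_i)` and the test `count = 0` -/
  | readOwnPathAgain
  /-- `bcc_i := path` -/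
  | writeOwnBcc
  /-- third loop: iteration `j` of the search for the parent link -/
  | bccLoop (j : Fin δ)
  /-- `bcc_i := read_bcc_j`, within iteration `j` of the third loop -/
  | writeReadBcc (j : Fin δ)

/-- State of a processor of degree `δ`: register, program counter, local variables.
(`rootPC` is used by the root only; `nodePC` and the local variables by the others only.) -/
structure NodeState (δ : ℕ) where
  reg : Register
  rootPC : RootPC
  nodePC : NodePC δ
  readPath : Fin δ → PathWord
  readBcc : Fin δ → PathWord
  path : PathWord
  count : ℤ

/-- Enter a loop `for j := 1 to δ`; `done` is where to go if there is no iteration. -/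
def firstPort {δ : ℕ} (body : Fin δ → NodePC δ) (done : NodePC δ) : NodePC δ :=
  if h : 0 < δ then body ⟨0, h⟩ else done

/-- Proceed from iteration `j` of a loop to the next one, or leave the loop to `done`. -/
def nextPort {δ : ℕ} (body : Fin δ → NodePC δ) (done : NodePC δ) (j : Fin δ) : NodePC δ :=
  if h : (j : ℕ) + 1 < δ then body ⟨(j : ℕ) + 1, h⟩ else done

/-- Where the program of a non-root processor starts over. -/
def restart (δ : ℕ) : NodePC δ := firstPort NodePC.readPath NodePC.writePath

/-- Minimum of a finite family of path words (the family is never empty for a non-root processor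
of a connected network). -/
noncomputable def minWord {δ : ℕ} (f : Fin δ → PathWord) : PathWord :=
  if h : (Finset.univ : Finset (Fin δ)).Nonempty then Finset.univ.inf' h f else []

/-- One atomic step of the root: forever write `path := ⊥`, `count := 0`, `bcc := ⊥`. -/
def rootStep {δ : ℕ} (s : NodeState δ) : NodeState δ :=
  match s.rootPC with
  | .writePath => { s with reg := { s.reg with path := [⊥] }, rootPC := .writeCount }
  | .writeCount => { s with reg := { s.reg with count := 0 }, rootPC := .writeBcc }
  | .writeBcc => { s with reg := { s.reg with bcc := [⊥] }, rootPC := .writePath }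

open Classical in
/-- One atomic step of a non-root processor of degree `δ`: at most one read or write of a register.
Arguments: the registers `nb j` of its neighbours, the index `own j` of the `j`-th link at the
processor itself, the index `far j` of the same link at its other end, and its current state. -/
noncomputable def nodeStep (N : ℕ) {δ : ℕ} (nb : Fin δ → Register) (own far : Fin δ → ℕ)
    (s : NodeState δ) : NodeState δ :=
  match s.nodePC with
  | .readPath j =>
      { s with
        readPath := Function.update s.readPath j (nb j).path
        nodePC := nextPort .readPath .writePath j }
  | .writePath =>
      { s with
        reg := { s.reg with
          path := minWord fun j => truncate N (s.readPath j ++ [(far j : Label)]) }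
        nodePC := .readOwnPath }
  | .readOwnPath =>
      { s with
        path := s.reg.path
        count := 0
        nodePC := firstPort .countLoop .writeCount }
  | .countLoop j =>
      { s with
        count :=
          -- child link
          if IsTreeExt s.path (own j) (s.readPath j) then s.count + (nb j).count
          -- incoming non-tree edge
          else if IsNonTreeExt s.path (own j) (s.readPath j) then s.count - 1
          -- outgoing non-tree edge
          else if IsNonTreeExt (s.readPath j) (far j) s.path then s.count + 1
          else s.count
        nodePC := nextPort .countLoop .writeCount j }
  | .writeCount =>
      { s with
        reg := { s.reg with count := s.count }
        nodePC := .readOwnCount }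
  | .readOwnCount =>
      { s with
        count := s.reg.count
        nodePC := .readOwnPathAgain }
  | .readOwnPathAgain =>
      { s with
        path := s.reg.path
        nodePC := if s.count = 0 then .writeOwnBcc else firstPort .bccLoop (restart δ) }
  | .writeOwnBcc =>
      { s with
        reg := { s.reg with bcc := s.path }
        nodePC := restart δ }
  | .bccLoop j =>
      -- parent link
      if IsTreeExt (s.readPath j) (far j) s.path then
        { s with
          readBcc := Function.update s.readBcc j (nb j).bcc
          nodePC := .writeReadBcc j }
      else
        { s with nodePC := nextPort .bccLoop (restart δ) j }
  | .writeReadBcc j =>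
      { s with
        reg := { s.reg with bcc := s.readBcc j }
        nodePC := nextPort .bccLoop (restart δ) j }

/-! ### Executions -/

/-- A configuration: one state for each processor. -/
abbrev Config (G : SimpleGraph V) [DecidableRel G.Adj] : Type _ := ∀ i : V, NodeState (G.degree i)

/-- The configuration that results if processor `i` executes one atomic step. -/
noncomputable def activate (α : PortNumbering G) (root : V) (N : ℕ) (c : Config G) (i : V) :
    Config G :=
  Function.update c i <|
    if i = root then rootStep (c i)
    else nodeStep N (fun j => (c (α.nbr i j)).reg) (fun j => α.idx i (α.nbr i j))
      (fun j => α.idx (α.nbr i j) i) (c i)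

/-- A fair execution, from an arbitrary initial configuration: a scheduler `σ` activates one
processor at a time, and every processor infinitely often. -/
def IsFairExecution (α : PortNumbering G) (root : V) (N : ℕ) (e : ℕ → Config G) : Prop :=
  ∃ σ : ℕ → V, (∀ t, e (t + 1) = activate α root N (e t) (σ t)) ∧
    ∀ i, ∃ᶠ t in Filter.atTop, σ t = i

/-! ### Reading off the registers -/

/-- The path fields of a configuration. -/
def pathOf (c : Config G) (i : V) : PathWord := (c i).reg.path

/-- The count fields of a configuration. -/
def countOf (c : Config G) (i : V) : ℤ := (c i).reg.count

/-- The bcc fields of a configuration. -/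
def bccOf (c : Config G) (i : V) : PathWord := (c i).reg.bcc

/-- `(i, j)` is a child link of `i`, that is, `i` is the parent of `j`. -/
def IsChildLink (α : PortNumbering G) (c : Config G) (i j : V) : Prop :=
  G.Adj i j ∧ IsTreeExt (pathOf c i) (α.idx i j) (pathOf c j)

/-- `(j, i)` is the parent link of `i`, that is, `j` is the parent of `i`. -/
def IsParentLink (α : PortNumbering G) (c : Config G) (i j : V) : Prop :=
  G.Adj i j ∧ IsTreeExt (pathOf c j) (α.idx j i) (pathOf c i)

/-- `(i, j)` is an outgoing non-tree edge of `i`. -/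
def IsOutgoing (α : PortNumbering G) (c : Config G) (i j : V) : Prop :=
  G.Adj i j ∧ IsNonTreeExt (pathOf c j) (α.idx j i) (pathOf c i)

/-- `(j, i)` is an incoming non-tree edge of `i`. -/
def IsIncoming (α : PortNumbering G) (c : Config G) (i j : V) : Prop :=
  G.Adj i j ∧ IsNonTreeExt (pathOf c i) (α.idx i j) (pathOf c j)

/-- `j` is an ancestor of `i` (possibly `i` itself): `path_j` is a prefix of `path_i`. -/
def IsAncestor (c : Config G) (j i : V) : Prop := pathOf c j <+: pathOf c i

/-- `incoming(v_j, v_i)`: the number of incoming non-tree edges `(l, i)` of `i` such that `l` is a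
descendant of `j`. -/
noncomputable def incomingFrom (α : PortNumbering G) (c : Config G) (j i : V) : ℕ :=
  {l : V | IsIncoming α c i l ∧ IsAncestor c j l}.ncard

/-- The non-tree edges `(k, l)`, with `k` a descendant of `l`, that bypass the parent link of `j`:
`k` is a descendant of `j` and `l` an ancestor of the parent of `j`. (Empty for the root, which has
no parent.) -/
def bypassing (α : PortNumbering G) (c : Config G) (j : V) : Set (V × V) :=
  {e | IsOutgoing α c e.1 e.2 ∧ IsAncestor c j e.1 ∧
    ∃ i, IsParentLink α c j i ∧ IsAncestor c e.2 i}

/-- The word of a walk: `⊥` followed by the edge indices along the walk, each one taken at the node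
at which the walk enters the link. -/
def walkWord (α : PortNumbering G) {u v : V} (p : G.Walk u v) : PathWord :=
  (⊥ : Label) :: p.darts.map fun d => ((α.idx d.fst d.snd : ℕ) : Label)

/-- The words of all simple paths from the root to `v`. -/
def simplePathWords (α : PortNumbering G) (root v : V) : Set PathWord :=
  {w | ∃ p : G.Walk root v, p.IsPath ∧ w = walkWord α p}

end Network

/-! ### The graph notions to be determined -/

/-- An articulation point: a node whose removal disconnects the graph. -/
def IsArticulationPoint {V : Type*} (G : SimpleGraph V) (v : V) : Prop :=
  ¬ (G.induce {v}ᶜ).Preconnected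

/-- `S` is the node set of a bridge-connected component of `G`: a maximal connected subgraph
without any bridge of `G`. -/
def IsBridgeConnectedComponent {V : Type*} (G : SimpleGraph V) (S : Set V) : Prop :=
  ∃ H : G.Subgraph,
    Maximal (fun K : G.Subgraph => K.Connected ∧ ∀ e ∈ K.edgeSet, ¬ G.IsBridge e) H ∧ H.verts = S

section Representative

variable {V : Type*} [Fintype V] {G : SimpleGraph V} [DecidableRel G.Adj]

/-- `t` is the representative node of the bridge-connected component with node set `S`: a node of
`S` that is an ancestor of all nodes of `S`. -/
def IsRepresentative (c : Config G) (t : V) (S : Set V) : Prop :=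
  t ∈ S ∧ ∀ v ∈ S, IsAncestor c t v

end Representative

end SelfStab

/-!
The algorithm builds the depth-first search tree in which every node explores its links in the order
of their indices, and then computes on this tree.

**Stabilization of the paths.** Processors never block, so every processor executes each operation
of its program infinitely often (`IsScheduledBy.visits_restart`), and a local property that is
established by one operation and destroyed by none holds from some time on
(`IsScheduledBy.eventually_of_visits`). The path fields stabilize in the lexicographic order of
their final values. Suppose those of a set `S` are stable, and let `m` be the least word
`path_u ⊕ α_u(x)` over the links that lead from `u ∈ S` to `x ∉ S`. Outside `S` the truncation to
`N` characters flushes out the arbitrary initial contents: such a path field eventually is either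
the word of a walk that has left `S`, hence extends the word of a link leaving `S` and is at least
`m`, or consists of `N` edge indices without `⊥`, which makes it larger than `m`
(`IsScheduledBy.eventually_isFlushed`). So the field of `x` becomes `m` for good
(`IsScheduledBy.eventually_pathOf_eq`).

**The tree.** The final values satisfy `path_v ≤ path_u ⊕ α_u(v)` for all links (`IsDFSTree`).
Therefore of two neighbours one is an ancestor of the other
(`IsDFSTree.isAncestor_or_isAncestor`), and `path_v` is the least word of a simple path: where a
simple path leaves the tree path, its word becomes larger at some position and remains so
(`IsDFSTree.eq_or_lt_walkWord`).

**Counts.** The numbers of bypassing edges satisfy the recursion that the processors evaluate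
(`IsDFSTree.ncard_bypassing_eq_sum`): an edge that bypasses the parent link of `v` starts at `v` or
bypasses the link to exactly one child of `v`, and the edges that bypass the latter but not the
former are those that end at `v`. The counts stabilize from the leaves upwards, and then the bcc
fields from the root downwards, each of them holding the path of the nearest ancestor whose count is
zero.

**Connectivity.** A link that leaves the set of descendants of `v` is the parent link of `v` or
bypasses it (`IsDFSTree.mem_bypassing_of_adj`). Hence a tree link that is not bypassed is a bridge,
and the descendants of a child `u` of `v` are cut off by removing `v` if all edges that bypass the
link to `u` end at `v`. Conversely, a bypassing edge closes a cycle through every tree link that it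
bypasses. Finally, the bridge-connected components are the classes of reachability without bridges
(`isBridgeConnectedComponent_iff`), and two nodes belong to the same class if and only if they have
the same nearest ancestor with count zero (`IsDFSTree.reachable_withoutBridges_iff`).
-/

set_option linter.unusedSectionVars false

namespace SelfStab

open Filter

/-! ### The lexicographic order on path words -/

theorem PathWord.le_append (a s : PathWord) : a ≤ a ++ s := by
  induction a with
  | nil => exact le_of_not_gt (List.not_lt_nil _)
  | cons x a ih => exact List.cons_le_cons x ih

/-- If `a` is smaller than `b` for another reason than being a prefix, the two words differ at some
position, so that the comparison does not depend on how they are continued. -/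
theorem PathWord.append_lt_append {a b : PathWord} (hlt : a < b) (hp : ¬ a <+: b)
    (s t : PathWord) : a ++ s < b ++ t := by
  induction a generalizing b with
  | nil => exact absurd (List.nil_prefix) hp
  | cons x a ih =>
    cases b with
    | nil => exact absurd hlt (List.not_lt_nil _)
    | cons y b =>
      rw [List.cons_append, List.cons_append, List.cons_lt_cons_iff]
      rcases List.cons_lt_cons_iff.1 hlt with h | ⟨rfl, h⟩
      · exact Or.inl h
      · exact Or.inr ⟨rfl, ih h fun hab => hp ((List.cons_prefix_cons).2 ⟨rfl, hab⟩)⟩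

theorem bot_cons_lt {w : PathWord} (h0 : w ≠ []) (hw : ∀ c ∈ w, c ≠ ⊥) (m : PathWord) :
    ((⊥ : Label) :: m : PathWord) < w := by
  cases w with
  | nil => exact absurd rfl h0
  | cons x w =>
    exact List.cons_lt_cons_iff.2 (Or.inl (bot_lt_iff_ne_bot.2 (hw x (by simp))))

theorem truncate_of_length_le {N : ℕ} {w : PathWord} (h : w.length ≤ N) : truncate N w = w := by
  simp [truncate, List.rtake, Nat.sub_eq_zero_of_le h]

theorem truncate_suffix (N : ℕ) (w : PathWord) : truncate N w <:+ w := List.drop_suffix _ _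

theorem length_truncate (N : ℕ) (w : PathWord) : (truncate N w).length = min N w.length := by
  simp only [truncate, List.rtake, List.length_drop]
  omega

theorem minWord_le {δ : ℕ} (f : Fin δ → PathWord) (j : Fin δ) : minWord f ≤ f j := by
  have h : (Finset.univ : Finset (Fin δ)).Nonempty := ⟨j, Finset.mem_univ j⟩
  rw [minWord, dif_pos h]
  exact Finset.inf'_le _ (Finset.mem_univ j)

theorem exists_minWord_eq {δ : ℕ} (hδ : 0 < δ) (f : Fin δ → PathWord) : ∃ j, minWord f = f j := by
  have h : (Finset.univ : Finset (Fin δ)).Nonempty := ⟨⟨0, hδ⟩, Finset.mem_univ _⟩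
  rw [minWord, dif_pos h]
  obtain ⟨j, -, hj⟩ := Finset.exists_mem_eq_inf' h f
  exact ⟨j, hj⟩

/-! ### Fair executions -/

theorem eventually_of_preserved {P : ℕ → Prop} (hp : ∀ᶠ t in atTop, P t → P (t + 1))
    (hf : ∃ᶠ t in atTop, P t) : ∀ᶠ t in atTop, P t := by
  obtain ⟨T, hT⟩ := eventually_atTop.1 hp
  obtain ⟨T', hT', h⟩ := frequently_atTop.1 hf T
  refine eventually_atTop.2 ⟨T', fun t ht => ?_⟩
  induction t, ht using Nat.le_induction with
  | base => exact h
  | succ t ht ih => exact hT t (hT'.trans ht) ih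

section Execution

variable {V : Type*} [Fintype V] [DecidableEq V] {G : SimpleGraph V} [DecidableRel G.Adj]

/-- The state of the non-root processor `i` after it has executed an atomic step in the
configuration `c`. -/
noncomputable def localStep (α : PortNumbering G) (N : ℕ) (c : Config G) (i : V) :
    NodeState (G.degree i) :=
  nodeStep N (fun j => (c (α.nbr i j)).reg) (fun j => α.idx i (α.nbr i j))
    (fun j => α.idx (α.nbr i j) i) (c i)

/-- `e` is the execution in which the fair scheduler `σ` chooses the processors. -/
structure IsScheduledBy (α : PortNumbering G) (root : V) (N : ℕ) (e : ℕ → Config G)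
    (σ : ℕ → V) : Prop where
  step : ∀ t, e (t + 1) = activate α root N (e t) (σ t)
  fair : ∀ i, ∃ᶠ t in atTop, σ t = i

/-- Processor `i` executes infinitely often the operation at the program counter `p`. -/
def Visits (e : ℕ → Config G) (σ : ℕ → V) (i : V) (p : NodePC (G.degree i)) : Prop :=
  ∃ᶠ t in atTop, σ t = i ∧ (e t i).nodePC = p

namespace IsScheduledBy

variable {α : PortNumbering G} {root : V} {N : ℕ} {e : ℕ → Config G} {σ : ℕ → V}

theorem step_of_ne (h : IsScheduledBy α root N e σ) {i : V} {t : ℕ} (hi : σ t ≠ i) :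
    e (t + 1) i = e t i := by
  rw [h.step t, activate, Function.update_of_ne hi.symm]

theorem step_root (h : IsScheduledBy α root N e σ) {t : ℕ} (hi : σ t = root) :
    e (t + 1) root = rootStep (e t root) := by
  rw [h.step t, activate, hi, Function.update_self, if_pos rfl]

theorem step_node (h : IsScheduledBy α root N e σ) {i : V} (hr : i ≠ root) {t : ℕ}
    (hi : σ t = i) : e (t + 1) i = localStep α N (e t) i := by
  rw [h.step t, activate, hi, Function.update_self, if_neg hr, localStep]

/-- What holds of a processor right after infinitely many instants also holds at infinitely many of
its own activations, since its state does not change before its next activation. -/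
theorem frequently_next (h : IsScheduledBy α root N e σ) {i : V} {P : ℕ → Prop}
    {Q : NodeState (G.degree i) → Prop} (hP : ∃ᶠ t in atTop, P t)
    (hPQ : ∀ᶠ t in atTop, P t → Q (e (t + 1) i)) :
    ∃ᶠ t in atTop, σ t = i ∧ Q (e t i) := by
  rw [frequently_atTop]
  intro T
  obtain ⟨t, ht, hPt, hQt⟩ := frequently_atTop.1 (hP.and_eventually hPQ) T
  have hex : ∃ s, t + 1 ≤ s ∧ σ s = i := frequently_atTop.1 (h.fair i) (t + 1)
  classical
  have hfind := Nat.find_spec hex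
  have key : ∀ s, t + 1 ≤ s → s ≤ Nat.find hex → Q (e s i) := by
    intro s hs
    induction s, hs using Nat.le_induction with
    | base => exact fun _ => hQt hPt
    | succ s hs ih =>
      intro hle
      have hne : σ s ≠ i := fun hσ => Nat.find_min hex hle ⟨hs, hσ⟩
      rw [h.step_of_ne hne]
      exact ih (by omega)
  exact ⟨Nat.find hex, by omega, hfind.2, key _ hfind.1 le_rfl⟩

theorem eventually_invariant (h : IsScheduledBy α root N e σ) {i : V} (hr : i ≠ root)
    {Q : NodeState (G.degree i) → Prop}
    (hstep : ∀ᶠ t in atTop, Q (e t i) → Q (localStep α N (e t) i))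
    (hf : ∃ᶠ t in atTop, Q (e t i)) : ∀ᶠ t in atTop, Q (e t i) := by
  refine eventually_of_preserved ?_ hf
  filter_upwards [hstep] with t ht hQ
  by_cases hσ : σ t = i
  · rw [h.step_node hr hσ]
    exact ht hQ
  · rwa [h.step_of_ne hσ]

/-- A local property that the operation at `p` establishes and no operation destroys holds from some
time on if the operation at `p` is executed infinitely often. -/
theorem eventually_of_visits (h : IsScheduledBy α root N e σ) {i : V} (hr : i ≠ root)
    {p : NodePC (G.degree i)} {Q : NodeState (G.degree i) → Prop} (hv : Visits e σ i p)
    (hest : ∀ᶠ t in atTop, (e t i).nodePC = p → Q (localStep α N (e t) i))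
    (hstep : ∀ᶠ t in atTop, Q (e t i) → Q (localStep α N (e t) i)) :
    ∀ᶠ t in atTop, Q (e t i) := by
  refine h.eventually_invariant hr hstep ?_
  refine (h.frequently_next hv (Q := Q) ?_).mono fun t ht => ht.2
  filter_upwards [hest] with t ht hp
  rw [h.step_node hr hp.1]
  exact ht hp.2

theorem visits_next (h : IsScheduledBy α root N e σ) {i : V} (hr : i ≠ root)
    {p q : NodePC (G.degree i)} (hv : Visits e σ i p)
    (hpq : ∀ᶠ t in atTop, (e t i).nodePC = p → (localStep α N (e t) i).nodePC = q) :
    Visits e σ i q := by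
  refine h.frequently_next hv (Q := fun s => s.nodePC = q) ?_
  filter_upwards [hpq] with t ht hp
  rw [h.step_node hr hp.1]
  exact ht hp.2

/-- The iterations of a loop are executed one after the other, up to an iteration `j` before which
the loop is never left. -/
theorem visits_body (h : IsScheduledBy α root N e σ) {i : V} (hr : i ≠ root)
    {body : Fin (G.degree i) → NodePC (G.degree i)} {done : NodePC (G.degree i)}
    (hδ : 0 < G.degree i) (hv : Visits e σ i (firstPort body done)) (j : Fin (G.degree i))
    (hnext : ∀ k < j, ∀ᶠ t in atTop, (e t i).nodePC = body k →
      (localStep α N (e t) i).nodePC = nextPort body done k) :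
    Visits e σ i (body j) := by
  obtain ⟨k, hk⟩ := j
  induction k with
  | zero => rwa [firstPort, dif_pos hδ] at hv
  | succ k ih =>
    have hk' : k < G.degree i := by omega
    have := h.visits_next hr
      (ih hk' fun l hl => hnext l (hl.trans (by simp [Fin.lt_def])))
      (hnext ⟨k, hk'⟩ (by simp [Fin.lt_def]))
    rwa [nextPort, dif_pos hk] at this

theorem visits_done (h : IsScheduledBy α root N e σ) {i : V} (hr : i ≠ root)
    {body : Fin (G.degree i) → NodePC (G.degree i)} {done : NodePC (G.degree i)}
    (hδ : 0 < G.degree i) (hv : Visits e σ i (firstPort body done))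
    (hnext : ∀ k, ∀ᶠ t in atTop, (e t i).nodePC = body k →
      (localStep α N (e t) i).nodePC = nextPort body done k) :
    Visits e σ i done := by
  have := h.visits_next hr
    (h.visits_body hr hδ hv ⟨G.degree i - 1, by omega⟩ fun k _ => hnext k) (hnext _)
  rwa [nextPort, dif_neg (by simp only; omega)] at this

end IsScheduledBy

/-! ### Control flow -/

/-- A bound on the number of steps after which a non-root processor of degree `δ > 0` starts over:
each summand allows for the remaining iterations of a loop, and an iteration of the third loop
takes up to two steps. -/
def stepsToRestart {δ : ℕ} : NodePC δ → ℕ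
  | .readPath j => if (j : ℕ) = 0 then 0 else 3 * δ + 5 + (δ - j)
  | .writePath => 3 * δ + 5
  | .readOwnPath => 3 * δ + 4
  | .countLoop j => 2 * δ + 3 + (δ - j)
  | .writeCount => 2 * δ + 3
  | .readOwnCount => 2 * δ + 2
  | .readOwnPathAgain => 2 * δ + 1
  | .writeOwnBcc => 1
  | .bccLoop j => 2 * (δ - j)
  | .writeReadBcc j => 2 * (δ - j) - 1

theorem stepsToRestart_nodeStep {N δ : ℕ} (hδ : 0 < δ) (nb : Fin δ → Register)
    (own far : Fin δ → ℕ) (s : NodeState δ) (hs : stepsToRestart s.nodePC ≠ 0) :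
    stepsToRestart (nodeStep N nb own far s).nodePC < stepsToRestart s.nodePC := by
  obtain ⟨reg, rpc, pc, rp, rb, path, count⟩ := s
  cases pc with
  | readPath j =>
    have := j.2
    have hj : (j : ℕ) ≠ 0 := fun h0 => hs (by simp [stepsToRestart, h0])
    simp only [nodeStep, nextPort]
    split_ifs <;> simp only [stepsToRestart, if_neg hj]
    · rw [if_neg (by simp)]
      omega
    · omega
  | countLoop j =>
    have := j.2
    simp only [nodeStep, nextPort]
    split_ifs <;> simp only [stepsToRestart] <;> omega
  | bccLoop j =>
    have := j.2
    simp only [nodeStep, nextPort, restart, firstPort, dif_pos hδ]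
    split_ifs <;> simp only [stepsToRestart, if_true] <;> omega
  | writeReadBcc j =>
    have := j.2
    simp only [nodeStep, nextPort, restart, firstPort, dif_pos hδ]
    split_ifs <;> simp only [stepsToRestart, if_true] <;> omega
  | readOwnPathAgain =>
    simp only [nodeStep, firstPort, dif_pos hδ]
    split_ifs <;> simp only [stepsToRestart] <;> omega
  | writeOwnBcc => simp [nodeStep, stepsToRestart, restart, firstPort, hδ]
  | readOwnPath =>
    simp only [nodeStep, firstPort, dif_pos hδ, stepsToRestart]
    omega
  | _ => simp [nodeStep, stepsToRestart]

theorem eq_restart_of_stepsToRestart {δ : ℕ} (hδ : 0 < δ) {p : NodePC δ}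
    (hp : stepsToRestart p = 0) : p = restart δ := by
  rw [restart, firstPort, dif_pos hδ]
  cases p with
  | readPath j =>
    simp only [stepsToRestart] at hp
    split_ifs at hp with hj
    · congr 1
      exact Fin.ext hj
    · omega
  | countLoop j => have := j.2; simp [stepsToRestart] at hp
  | bccLoop j => have := j.2; simp [stepsToRestart] at hp; omega
  | writeReadBcc j => have := j.2; simp [stepsToRestart] at hp; omega
  | _ => simp [stepsToRestart] at hp

namespace IsScheduledBy

variable {α : PortNumbering G} {root : V} {N : ℕ} {e : ℕ → Config G} {σ : ℕ → V}

/-- No processor blocks: from every state it starts over after boundedly many steps. -/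
theorem visits_restart (h : IsScheduledBy α root N e σ) {i : V} (hr : i ≠ root)
    (hδ : 0 < G.degree i) : Visits e σ i (restart (G.degree i)) := by
  have key : ∀ k, (∃ᶠ t in atTop, σ t = i ∧ stepsToRestart (e t i).nodePC ≤ k) →
      Visits e σ i (restart (G.degree i)) := by
    intro k
    induction k with
    | zero =>
      exact fun hk => hk.mono fun t ht =>
        ⟨ht.1, eq_restart_of_stepsToRestart hδ (Nat.le_zero.1 ht.2)⟩
    | succ k ih =>
      intro hk
      by_cases h0 : ∃ᶠ t in atTop, σ t = i ∧ stepsToRestart (e t i).nodePC = 0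
      · exact h0.mono fun t ht => ⟨ht.1, eq_restart_of_stepsToRestart hδ ht.2⟩
      · refine ih (h.frequently_next hk (Q := fun s => stepsToRestart s.nodePC ≤ k) ?_)
        filter_upwards [not_frequently.1 h0] with t ht hp
        have hlt := stepsToRestart_nodeStep (N := N) hδ (fun j => (e t (α.nbr i j)).reg)
          (fun j => α.idx i (α.nbr i j)) (fun j => α.idx (α.nbr i j) i) (e t i)
          fun h0 => ht ⟨hp.1, h0⟩
        rw [h.step_node hr hp.1, localStep]
        omega
  refine key (4 * G.degree i + 5) ((h.fair i).mono fun t ht => ⟨ht, ?_⟩)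
  cases (e t i).nodePC <;> simp only [stepsToRestart] <;> first | omega | (split_ifs <;> omega)

theorem visits_readPath (h : IsScheduledBy α root N e σ) {i : V} (hr : i ≠ root)
    (j : Fin (G.degree i)) : Visits e σ i (.readPath j) := by
  have hδ : 0 < G.degree i := j.pos
  refine h.visits_body hr hδ (h.visits_restart hr hδ) j fun k _ => .of_forall fun t hp => ?_
  simp only [localStep, nodeStep, hp]

theorem visits_writePath (h : IsScheduledBy α root N e σ) {i : V} (hr : i ≠ root)
    (hδ : 0 < G.degree i) : Visits e σ i .writePath := by
  refine h.visits_done hr hδ (h.visits_restart hr hδ) fun k => .of_forall fun t hp => ?_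
  simp only [localStep, nodeStep, hp]

theorem visits_readOwnPath (h : IsScheduledBy α root N e σ) {i : V} (hr : i ≠ root)
    (hδ : 0 < G.degree i) : Visits e σ i .readOwnPath := by
  refine h.visits_next hr (h.visits_writePath hr hδ) (.of_forall fun t hp => ?_)
  simp only [localStep, nodeStep, hp]

theorem visits_writeCount (h : IsScheduledBy α root N e σ) {i : V} (hr : i ≠ root)
    (hδ : 0 < G.degree i) : Visits e σ i .writeCount := by
  refine h.visits_done (body := .countLoop) hr hδ
    (h.visits_next hr (h.visits_readOwnPath hr hδ) (.of_forall fun t hp => ?_))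
    fun k => .of_forall fun t hp => ?_ <;>
  simp only [localStep, nodeStep, hp]

theorem visits_readOwnCount (h : IsScheduledBy α root N e σ) {i : V} (hr : i ≠ root)
    (hδ : 0 < G.degree i) : Visits e σ i .readOwnCount := by
  refine h.visits_next hr (h.visits_writeCount hr hδ) (.of_forall fun t hp => ?_)
  simp only [localStep, nodeStep, hp]

theorem visits_readOwnPathAgain (h : IsScheduledBy α root N e σ) {i : V} (hr : i ≠ root)
    (hδ : 0 < G.degree i) : Visits e σ i .readOwnPathAgain := by
  refine h.visits_next hr (h.visits_readOwnCount hr hδ) (.of_forall fun t hp => ?_)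
  simp only [localStep, nodeStep, hp]

end IsScheduledBy

end Execution

section Convergence

variable {V : Type*} [Fintype V] [DecidableEq V] {G : SimpleGraph V} [DecidableRel G.Adj]

/-! ### Port numberings -/

theorem PortNumbering.adj_nbr (α : PortNumbering G) (i : V) (j : Fin (G.degree i)) :
    G.Adj i (α.nbr i j) := (α i j).2

theorem PortNumbering.exists_nbr_eq (α : PortNumbering G) {i u : V} (h : G.Adj i u) :
    ∃ j, α.nbr i j = u :=
  ⟨(α i).symm ⟨u, h⟩, by simp [PortNumbering.nbr]⟩

theorem PortNumbering.nbr_injective (α : PortNumbering G) (i : V) :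
    Function.Injective (α.nbr i) :=
  fun _ _ h => (α i).injective (Subtype.ext h)

theorem PortNumbering.idx_injective (α : PortNumbering G) {i u v : V} (hu : G.Adj i u)
    (hv : G.Adj i v) (h : α.idx i u = α.idx i v) : u = v := by
  rw [PortNumbering.idx, PortNumbering.idx, dif_pos hu, dif_pos hv] at h
  have := (α i).symm.injective (Fin.ext (Nat.succ_injective h))
  exact congrArg Subtype.val this

/-! ### Stabilization of the root -/

namespace IsScheduledBy

variable {α : PortNumbering G} {root : V} {N : ℕ} {e : ℕ → Config G} {σ : ℕ → V}

theorem frequently_rootPC (h : IsScheduledBy α root N e σ) (p : RootPC) :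
    ∃ᶠ t in atTop, σ t = root ∧ (e t root).rootPC = p := by
  have next : ∀ p q : RootPC, (∀ s : NodeState (G.degree root), s.rootPC = p →
      (rootStep s).rootPC = q) → (∃ᶠ t in atTop, σ t = root ∧ (e t root).rootPC = p) →
      ∃ᶠ t in atTop, σ t = root ∧ (e t root).rootPC = q := by
    intro p q hpq hp
    refine h.frequently_next hp (Q := fun s => s.rootPC = q) (.of_forall fun t ht => ?_)
    rw [h.step_root ht.1]
    exact hpq _ ht.2
  have h12 := next .writePath .writeCount fun s hs => by simp only [rootStep, hs]
  have h23 := next .writeCount .writeBcc fun s hs => by simp only [rootStep, hs]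
  have h31 := next .writeBcc .writePath fun s hs => by simp only [rootStep, hs]
  have hsome : (∃ᶠ t in atTop, σ t = root ∧ (e t root).rootPC = .writePath) ∨
      (∃ᶠ t in atTop, σ t = root ∧ (e t root).rootPC = .writeCount) ∨
      (∃ᶠ t in atTop, σ t = root ∧ (e t root).rootPC = .writeBcc) := by
    rw [← frequently_or_distrib, ← frequently_or_distrib]
    refine (h.fair root).mono fun t ht => ?_
    cases (e t root).rootPC <;> simp [ht]
  cases p <;> tauto

theorem eventually_root (h : IsScheduledBy α root N e σ) {Q : NodeState (G.degree root) → Prop}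
    (p : RootPC) (hest : ∀ s, s.rootPC = p → Q (rootStep s)) (hstep : ∀ s, Q s → Q (rootStep s)) :
    ∀ᶠ t in atTop, Q (e t root) := by
  refine eventually_of_preserved (.of_forall fun t hQ => ?_) ((h.frequently_next
    (h.frequently_rootPC p) (Q := Q) (.of_forall fun t ht => ?_)).mono fun t ht => ht.2)
  · by_cases hσ : σ t = root
    · rw [h.step_root hσ]
      exact hstep _ hQ
    · rwa [h.step_of_ne hσ]
  · rw [h.step_root ht.1]
    exact hest _ ht.2

theorem eventually_pathOf_root (h : IsScheduledBy α root N e σ) :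
    ∀ᶠ t in atTop, pathOf (e t) root = [⊥] := by
  refine h.eventually_root (Q := fun s => s.reg.path = [⊥]) .writePath (fun s hs => ?_)
    fun s hs => ?_
  · simp only [rootStep, hs]
  · cases hp : s.rootPC <;> simp only [rootStep, hp, hs]

theorem eventually_countOf_root (h : IsScheduledBy α root N e σ) :
    ∀ᶠ t in atTop, countOf (e t) root = 0 := by
  refine h.eventually_root (Q := fun s => s.reg.count = 0) .writeCount (fun s hs => ?_)
    fun s hs => ?_
  · simp only [rootStep, hs]
  · cases hp : s.rootPC <;> simp only [rootStep, hp, hs]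

theorem eventually_bccOf_root (h : IsScheduledBy α root N e σ) :
    ∀ᶠ t in atTop, bccOf (e t) root = [⊥] := by
  refine h.eventually_root (Q := fun s => s.reg.bcc = [⊥]) .writeBcc (fun s hs => ?_)
    fun s hs => ?_
  · simp only [rootStep, hs]
  · cases hp : s.rootPC <;> simp only [rootStep, hp, hs]

/-! ### Stabilization of the path fields -/

theorem eventually_readPath (h : IsScheduledBy α root N e σ) {i : V} (hr : i ≠ root)
    (j : Fin (G.degree i)) {P : PathWord → Prop}
    (hP : ∀ᶠ t in atTop, P (pathOf (e t) (α.nbr i j))) :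
    ∀ᶠ t in atTop, P ((e t i).readPath j) := by
  refine h.eventually_of_visits hr (Q := fun s => P (s.readPath j)) (h.visits_readPath hr j) ?_ ?_
  · filter_upwards [hP] with t ht hp
    simp only [localStep, nodeStep, hp, Function.update_self]
    exact ht
  · filter_upwards [hP] with t ht hQ
    cases hp : (e t i).nodePC with
    | readPath k =>
      simp only [localStep, nodeStep, hp]
      rcases eq_or_ne j k with rfl | hjk
      · rw [Function.update_self]
        exact ht
      · rwa [Function.update_of_ne hjk]
    | bccLoop k => simp only [localStep, nodeStep, hp]; split_ifs <;> exact hQ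
    | _ => simpa only [localStep, nodeStep, hp] using hQ

/-- Whatever holds from some time on of the path fields of the neighbours of `i` may be used to
determine the path field that `i` computes from them. -/
theorem eventually_pathOf (h : IsScheduledBy α root N e σ) {i : V} (hr : i ≠ root)
    (hδ : 0 < G.degree i) {P : V → PathWord → Prop}
    (hP : ∀ u, G.Adj i u → ∀ᶠ t in atTop, P u (pathOf (e t) u)) {R : PathWord → Prop}
    (hR : ∀ f : Fin (G.degree i) → PathWord, (∀ j, P (α.nbr i j) (f j)) →
      R (minWord fun j => truncate N (f j ++ [(α.idx (α.nbr i j) i : Label)]))) :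
    ∀ᶠ t in atTop, R (pathOf (e t) i) := by
  have hread : ∀ᶠ t in atTop, ∀ j, P (α.nbr i j) ((e t i).readPath j) :=
    eventually_all.2 fun j => h.eventually_readPath hr j (hP _ (α.adj_nbr i j))
  refine h.eventually_of_visits hr (Q := fun s => R s.reg.path) (h.visits_writePath hr hδ) ?_ ?_
  · filter_upwards [hread] with t ht hp
    simp only [localStep, nodeStep, hp]
    exact hR _ ht
  · filter_upwards [hread] with t ht hQ
    cases hp : (e t i).nodePC with
    | writePath =>
      simp only [localStep, nodeStep, hp]
      exact hR _ ht
    | bccLoop k => simp only [localStep, nodeStep, hp]; split_ifs <;> exact hQ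
    | _ => simpa only [localStep, nodeStep, hp] using hQ

end IsScheduledBy

/-- `val` labels the nodes with the words of the tree paths of a depth-first search tree, the one
that results if every node explores its links in the order of their indices. -/
structure IsDFSTree (α : PortNumbering G) (root : V) (val : V → PathWord) : Prop where
  root_eq : val root = [⊥]
  exists_parent : ∀ v, v ≠ root → ∃ u, G.Adj u v ∧ val v = val u ++ [(α.idx u v : Label)]
  le_append : ∀ u v, G.Adj u v → val v ≤ val u ++ [(α.idx u v : Label)]

/-- `val` labels the nodes of `S` as in `IsDFSTree`, and `S` consists of the nodes with the smallest
labels: no link that leaves `S` offers a smaller one. -/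
structure IsPartialDFSTree (α : PortNumbering G) (root : V) (S : Finset V) (val : V → PathWord) :
    Prop where
  root_mem : root ∈ S
  root_eq : val root = [⊥]
  exists_parent : ∀ v ∈ S, v ≠ root →
    ∃ u ∈ S, G.Adj u v ∧ val v = val u ++ [(α.idx u v : Label)]
  length_le : ∀ v ∈ S, (val v).length ≤ S.card
  shape : ∀ v ∈ S, ∃ w, val v = ⊥ :: w ∧ ∀ c ∈ w, c ≠ ⊥
  le_append : ∀ u ∈ S, ∀ v ∈ S, G.Adj u v → val v ≤ val u ++ [(α.idx u v : Label)]
  le_leaving : ∀ v ∈ S, ∀ u ∈ S, ∀ y ∉ S, G.Adj u y → val v ≤ val u ++ [(α.idx u y : Label)]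

namespace IsPartialDFSTree

variable {α : PortNumbering G} {root : V} {S : Finset V} {val : V → PathWord}

theorem singleton (α : PortNumbering G) (root : V) :
    IsPartialDFSTree α root {root} fun _ => [⊥] where
  root_mem := by simp
  root_eq := rfl
  exists_parent v hv hr := absurd (Finset.mem_singleton.1 hv) hr
  length_le := by simp
  shape v _ := ⟨[], rfl, by simp⟩
  le_append u hu v hv h := by
    rw [Finset.mem_singleton] at hu hv
    exact absurd (hu.trans hv.symm) h.ne
  le_leaving _ _ _ _ _ _ _ := PathWord.le_append _ _

/-- A step of the greedy construction: the node at the end of the best link leaving `S` is added. -/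
theorem insert (hS : IsPartialDFSTree α root S val) {u x : V} (hu : u ∈ S) (hx : x ∉ S)
    (hux : G.Adj u x)
    (hmin : ∀ u' ∈ S, ∀ x' ∉ S, G.Adj u' x' →
      val u ++ [(α.idx u x : Label)] ≤ val u' ++ [(α.idx u' x' : Label)]) :
    IsPartialDFSTree α root (insert x S)
      (Function.update val x (val u ++ [(α.idx u x : Label)])) := by
  have hne : ∀ v ∈ S, v ≠ x := fun v hv h => hx (h ▸ hv)
  have hval : ∀ v ∈ S, Function.update val x (val u ++ [(α.idx u x : Label)]) v = val v :=
    fun v hv => Function.update_of_ne (hne v hv) _ _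
  have hself : Function.update val x (val u ++ [(α.idx u x : Label)]) x =
    val u ++ [(α.idx u x : Label)] := Function.update_self ..
  refine ⟨Finset.mem_insert_of_mem hS.root_mem, ?_, ?_, ?_, ?_, ?_, ?_⟩
  · rw [hval _ hS.root_mem, hS.root_eq]
  · intro v hv hr
    rcases Finset.mem_insert.1 hv with rfl | hv
    · exact ⟨u, Finset.mem_insert_of_mem hu, hux, by rw [hself, hval u hu]⟩
    · obtain ⟨p, hpS, hp, h⟩ := hS.exists_parent v hv hr
      exact ⟨p, Finset.mem_insert_of_mem hpS, hp, by rw [hval v hv, hval p hpS, h]⟩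
  · intro v hv
    rw [Finset.card_insert_of_notMem hx]
    rcases Finset.mem_insert.1 hv with rfl | hv
    · rw [hself, List.length_append]
      exact Nat.add_le_add_right (hS.length_le u hu) 1
    · rw [hval v hv]
      exact (hS.length_le v hv).trans (Nat.le_succ _)
  · intro v hv
    rcases Finset.mem_insert.1 hv with rfl | hv
    · obtain ⟨w, hw, hwc⟩ := hS.shape u hu
      refine ⟨w ++ [(α.idx u v : Label)], by rw [hself, hw, List.cons_append], fun c hc => ?_⟩
      rcases List.mem_append.1 hc with hc | hc
      · exact hwc c hc
      · rw [List.mem_singleton.1 hc]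
        exact WithBot.coe_ne_bot
    · rw [hval v hv]
      exact hS.shape v hv
  · intro a ha b hb hab
    rcases Finset.mem_insert.1 ha with rfl | ha' <;> rcases Finset.mem_insert.1 hb with rfl | hb'
    · exact absurd rfl hab.ne
    · rw [hself, hval b hb']
      exact (hS.le_leaving b hb' u hu _ hx hux).trans (PathWord.le_append _ _)
    · rw [hself, hval a ha']
      exact hmin a ha' _ hx hab
    · rw [hval a ha', hval b hb']
      exact hS.le_append a ha' b hb' hab
  · intro v hv a ha y hy hay
    have hyS : y ∉ S := fun h => hy (Finset.mem_insert_of_mem h)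
    rcases Finset.mem_insert.1 ha with rfl | ha' <;> rcases Finset.mem_insert.1 hv with rfl | hv'
    · exact PathWord.le_append _ _
    · rw [hself, hval v hv']
      exact (hS.le_leaving v hv' u hu _ hx hux).trans (PathWord.le_append _ _)
    · rw [hself, hval a ha']
      exact hmin a ha' y hyS hay
    · rw [hval a ha', hval v hv']
      exact hS.le_leaving v hv' a ha' y hyS hay

theorem isDFSTree (hS : IsPartialDFSTree α root Finset.univ val) : IsDFSTree α root val where
  root_eq := hS.root_eq
  exists_parent v hv := by
    obtain ⟨u, -, h⟩ := hS.exists_parent v (Finset.mem_univ v) hv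
    exact ⟨u, h⟩
  le_append u v := hS.le_append u (Finset.mem_univ u) v (Finset.mem_univ v)

end IsPartialDFSTree

/-- Arbitrary initial contents have been flushed out of the last `d` characters of `w`: either these
are edge indices, or `w` consists of edge indices after its first character and is not less than
`m`. -/
def IsFlushed (m : PathWord) (d : ℕ) (w : PathWord) : Prop :=
  (m ≤ w ∧ ∀ c ∈ w.tail, c ≠ ⊥) ∨ ∃ s, s <:+ w ∧ d ≤ s.length ∧ ∀ c ∈ s, c ≠ ⊥

theorem isFlushed_zero (m w : PathWord) : IsFlushed m 0 w :=
  Or.inr ⟨[], List.nil_suffix, le_rfl, by simp⟩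

/-- A computed word has one more flushed character than the words it is computed from. A truncated
word of the first kind loses its first character and thereby becomes one of the second kind. -/
theorem IsFlushed.truncate_append {m w : PathWord} {d N : ℕ} (h : IsFlushed m d w)
    (a : ℕ) : IsFlushed m (min N (d + 1)) (truncate N (w ++ [(a : Label)])) := by
  have ha : ∀ s : PathWord, (∀ c ∈ s, c ≠ ⊥) → ∀ c ∈ s ++ [(a : Label)], c ≠ ⊥ := by
    intro s hs c hc
    rcases List.mem_append.1 hc with hc | hc
    · exact hs c hc
    · rw [List.mem_singleton.1 hc]
      exact WithBot.coe_ne_bot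
  rcases h with ⟨hm, hw⟩ | ⟨s, hs, hd, hsc⟩
  · rcases le_or_gt (w ++ [(a : Label)]).length N with hlen | hlen
    · rw [truncate_of_length_le hlen]
      refine Or.inl ⟨hm.trans (PathWord.le_append _ _), ?_⟩
      cases w with
      | nil => simp
      | cons x w => exact ha w hw
    · -- the first character is cut off
      have hlen' : (truncate N (w ++ [(a : Label)])).length = N := by
        rw [length_truncate]
        exact min_eq_left hlen.le
      refine Or.inr ⟨_, List.suffix_refl _, by rw [hlen']; exact min_le_left _ _, fun c hc => ?_⟩
      refine ha w.tail hw c ((List.suffix_of_suffix_length_le (truncate_suffix _ _) ?_ ?_).subset hc)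
      · exact List.suffix_append_self_iff.2 (List.tail_suffix w)
      · simp only [List.length_append, List.length_singleton, List.length_tail] at hlen ⊢
        omega
  · have hs' : s ++ [(a : Label)] <:+ w ++ [(a : Label)] := List.suffix_append_self_iff.2 hs
    rcases List.suffix_or_suffix_of_suffix (truncate_suffix N _) hs' with h | h
    · refine Or.inr ⟨_, List.suffix_refl _, ?_, fun c hc => ha s hsc c (h.subset hc)⟩
      have := hs'.length_le
      rw [length_truncate]
      simp only [List.length_append, List.length_singleton] at this ⊢
      omega
    · refine Or.inr ⟨_, h, ?_, ha s hsc⟩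
      simp only [List.length_append, List.length_singleton]
      omega

/-- A word of `N` edge indices is larger than every word that starts with `⊥`. -/
theorem IsFlushed.le {m w : PathWord} {N : ℕ} (hN : 0 < N) (h : IsFlushed (⊥ :: m) N w)
    (hw : w.length ≤ N) : ⊥ :: m ≤ w := by
  rcases h with h | ⟨s, hs, hsN, hsc⟩
  · exact h.1
  · obtain rfl : s = w := hs.eq_of_length_le (hw.trans hsN)
    refine (bot_cons_lt ?_ hsc m).le
    rintro rfl
    exact absurd hsN (by simpa using hN.ne')

section Stage

variable {α : PortNumbering G} {root : V} {N : ℕ} {e : ℕ → Config G} {σ : ℕ → V} {S : Finset V}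
  {val : V → PathWord}

theorem IsPartialDFSTree.truncate_append (hS : IsPartialDFSTree α root S val)
    (hSN : S.card < N) {u : V} (hu : u ∈ S) (a : ℕ) :
    truncate N (val u ++ [(a : Label)]) = val u ++ [(a : Label)] := by
  refine truncate_of_length_le ?_
  have := hS.length_le u hu
  simp only [List.length_append, List.length_singleton]
  omega

/-- Once the path fields of a partial depth-first search tree are stable, all other path fields are
flushed: a path field that keeps its first character `⊥` describes a walk that leaves the tree
once and for all, so that its word cannot be less than that of the best link leaving the tree. -/
theorem IsScheduledBy.eventually_isFlushed (h : IsScheduledBy α root N e σ)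
    (hS : IsPartialDFSTree α root S val) (hSN : S.card < N)
    (hval : ∀ v ∈ S, ∀ᶠ t in atTop, pathOf (e t) v = val v) (hdeg : ∀ i, 0 < G.degree i)
    {m : PathWord}
    (hmin : ∀ u' ∈ S, ∀ x' ∉ S, G.Adj u' x' → m ≤ val u' ++ [(α.idx u' x' : Label)])
    {d : ℕ} (hd : d ≤ N) {y : V} (hy : y ∉ S) :
    ∀ᶠ t in atTop, IsFlushed m d (pathOf (e t) y) := by
  induction d generalizing y with
  | zero => exact .of_forall fun t => isFlushed_zero _ _
  | succ d ih =>
    have hyr : y ≠ root := fun hyr => hy (hyr ▸ hS.root_mem)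
    refine h.eventually_pathOf hyr (hdeg y)
      (P := fun u w => if u ∈ S then w = val u else IsFlushed m d w) ?_ ?_
    · intro u _
      split_ifs with hu
      · exact hval u hu
      · exact ih (by omega) hu
    · intro f hf
      obtain ⟨j, hj⟩ := exists_minWord_eq (hdeg y)
        fun j => truncate N (f j ++ [(α.idx (α.nbr y j) y : Label)])
      rw [hj]
      have hfj := hf j
      split_ifs at hfj with hu
      · rw [hfj, hS.truncate_append hSN hu]
        refine Or.inl ⟨hmin _ hu y hy (α.adj_nbr y j).symm, ?_⟩
        obtain ⟨w, hw, hwc⟩ := hS.shape _ hu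
        rw [hw]
        intro c hc
        rcases List.mem_append.1 hc with hc | hc
        · exact hwc c hc
        · rw [List.mem_singleton.1 hc]
          exact WithBot.coe_ne_bot
      · have := hfj.truncate_append (N := N) (α.idx (α.nbr y j) y)
        rwa [min_eq_right hd] at this

theorem IsScheduledBy.eventually_pathOf_eq (h : IsScheduledBy α root N e σ)
    (hS : IsPartialDFSTree α root S val) (hSN : S.card < N)
    (hval : ∀ v ∈ S, ∀ᶠ t in atTop, pathOf (e t) v = val v) (hdeg : ∀ i, 0 < G.degree i)
    {u x : V} (hu : u ∈ S) (hx : x ∉ S) (hux : G.Adj u x)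
    (hmin : ∀ u' ∈ S, ∀ x' ∉ S, G.Adj u' x' →
      val u ++ [(α.idx u x : Label)] ≤ val u' ++ [(α.idx u' x' : Label)]) :
    ∀ᶠ t in atTop, pathOf (e t) x = val u ++ [(α.idx u x : Label)] := by
  have hxr : x ≠ root := fun hxr => hx (hxr ▸ hS.root_mem)
  refine h.eventually_pathOf hxr (hdeg x) (P := fun u' w => if u' ∈ S then w = val u' else
    IsFlushed (val u ++ [(α.idx u x : Label)]) N w)
    (R := fun w => w = val u ++ [(α.idx u x : Label)]) ?_ ?_
  · intro u _
    split_ifs with hu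
    · exact hval u hu
    · exact h.eventually_isFlushed hS hSN hval hdeg hmin le_rfl hu
  · intro f hf
    refine le_antisymm ?_ ?_
    · obtain ⟨j, hj⟩ := α.exists_nbr_eq hux.symm
      have hfj := hf j
      rw [hj, if_pos hu] at hfj
      have := minWord_le (fun j => truncate N (f j ++ [(α.idx (α.nbr x j) x : Label)])) j
      rwa [hfj, hj, hS.truncate_append hSN hu] at this
    · obtain ⟨j, hj⟩ := exists_minWord_eq (hdeg x)
        fun j => truncate N (f j ++ [(α.idx (α.nbr x j) x : Label)])
      rw [hj]
      have hfj := hf j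
      split_ifs at hfj with hu'
      · rw [hfj, hS.truncate_append hSN hu']
        exact hmin _ hu' x hx (α.adj_nbr x j).symm
      · have := hfj.truncate_append (N := N) (α.idx (α.nbr x j) x)
        rw [min_eq_left (Nat.le_succ N)] at this
        obtain ⟨w, hw, -⟩ := hS.shape u hu
        rw [hw, List.cons_append] at this ⊢
        exact this.le (by omega) (by rw [length_truncate]; exact min_le_left _ _)

/-- The path fields stabilize one after the other, in the lexicographic order of their final
values. -/
theorem IsScheduledBy.exists_isPartialDFSTree (h : IsScheduledBy α root N e σ)
    (hG : G.Connected) (hdeg : ∀ i, 0 < G.degree i) (hN : Fintype.card V ≤ N) (k : ℕ)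
    (hk : k + 1 ≤ Fintype.card V) :
    ∃ (S : Finset V) (val : V → PathWord), S.card = k + 1 ∧ IsPartialDFSTree α root S val ∧
      ∀ v ∈ S, ∀ᶠ t in atTop, pathOf (e t) v = val v := by
  induction k with
  | zero =>
    refine ⟨{root}, fun _ => [⊥], by simp, .singleton α root, fun v hv => ?_⟩
    rw [Finset.mem_singleton.1 hv]
    exact h.eventually_pathOf_root
  | succ k ih =>
    obtain ⟨S, val, hcard, hS, hval⟩ := ih (by omega)
    classical
    let leaving : Finset (V × V) := Finset.univ.filter fun p => p.1 ∈ S ∧ p.2 ∉ S ∧ G.Adj p.1 p.2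
    have hne : leaving.Nonempty := by
      obtain ⟨y, hy⟩ : ∃ y, y ∉ S := by
        by_contra! hall
        have : S = Finset.univ := Finset.eq_univ_iff_forall.2 hall
        rw [this, Finset.card_univ] at hcard
        omega
      obtain ⟨p⟩ := hG.preconnected root y
      obtain ⟨d, -, hd1, hd2⟩ := p.exists_boundary_dart (S : Set V) hS.root_mem hy
      exact ⟨(d.fst, d.snd), Finset.mem_filter.2 ⟨Finset.mem_univ _, hd1, hd2, d.adj⟩⟩
    obtain ⟨⟨u, x⟩, hux, hmin⟩ := Finset.exists_min_image leaving
      (fun p => val p.1 ++ [(α.idx p.1 p.2 : Label)]) hne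
    obtain ⟨-, hu, hx, hadj⟩ := Finset.mem_filter.1 hux
    have hmin' : ∀ u' ∈ S, ∀ x' ∉ S, G.Adj u' x' →
        val u ++ [(α.idx u x : Label)] ≤ val u' ++ [(α.idx u' x' : Label)] :=
      fun u' hu' x' hx' h' =>
        hmin (u', x') (Finset.mem_filter.2 ⟨Finset.mem_univ _, hu', hx', h'⟩)
    refine ⟨insert x S, _, by rw [Finset.card_insert_of_notMem hx, hcard],
      hS.insert hu hx hadj hmin', fun v hv => ?_⟩
    rcases Finset.mem_insert.1 hv with rfl | hv
    · rw [Function.update_self]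
      exact h.eventually_pathOf_eq hS (by omega) hval hdeg hu hx hadj hmin'
    · rw [Function.update_of_ne (ne_of_mem_of_not_mem hv hx)]
      exact hval v hv

/-- The path fields eventually hold the labels of a depth-first search tree. -/
theorem IsScheduledBy.exists_isDFSTree (h : IsScheduledBy α root N e σ) (hG : G.Connected)
    (hN : Fintype.card V ≤ N) :
    ∃ val, IsDFSTree α root val ∧ ∀ᶠ t in atTop, pathOf (e t) = val := by
  suffices ∃ (S : Finset V) (val : V → PathWord), S = Finset.univ ∧ IsPartialDFSTree α root S val ∧
      ∀ v ∈ S, ∀ᶠ t in atTop, pathOf (e t) v = val v by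
    obtain ⟨S, val, rfl, hS, hval⟩ := this
    refine ⟨val, hS.isDFSTree, ?_⟩
    filter_upwards [eventually_all.2 fun v => hval v (Finset.mem_univ v)] with t ht
    exact funext ht
  rcases subsingleton_or_nontrivial V with hV | hV
  · refine ⟨{root}, fun _ => [⊥], ?_, .singleton α root, fun v _ => ?_⟩
    · exact Finset.eq_univ_iff_forall.2 fun v => Finset.mem_singleton.2 (Subsingleton.elim v root)
    · rw [Subsingleton.elim v root]
      exact h.eventually_pathOf_root
  · have hpos : 0 < Fintype.card V := Fintype.card_pos_iff.2 ⟨root⟩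
    obtain ⟨S, val, hcard, hS⟩ := h.exists_isPartialDFSTree hG
      (fun i => hG.preconnected.degree_pos_of_nontrivial i) hN (Fintype.card V - 1) (by omega)
    exact ⟨S, val, (Finset.card_eq_iff_eq_univ S).1 (by omega), hS⟩

end Stage

end Convergence

section Tree

variable {V : Type*} [Fintype V] [DecidableEq V] {G : SimpleGraph V} [DecidableRel G.Adj]
variable {α : PortNumbering G} {root : V} {c : Config G}

/-! ### Depth-first search trees -/

theorem isChildLink_iff_isParentLink {i j : V} : IsChildLink α c i j ↔ IsParentLink α c j i :=
  and_congr_left' (G.adj_comm i j)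

theorem isIncoming_iff_isOutgoing {i j : V} : IsIncoming α c i j ↔ IsOutgoing α c j i :=
  and_congr_left' (G.adj_comm i j)

theorem isNonTreeExt_iff {p w : PathWord} {a : ℕ} :
    IsNonTreeExt p a w ↔ p <+: w ∧ ¬ IsTreeExt p a w := by
  constructor
  · rintro ⟨s, rfl, hs⟩
    exact ⟨List.prefix_append _ _, fun h => hs (List.append_cancel_left h)⟩
  · rintro ⟨⟨s, rfl⟩, hs⟩
    exact ⟨s, rfl, fun h => hs (by rw [IsTreeExt, h])⟩

theorem isOutgoing_iff {i j : V} :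
    IsOutgoing α c i j ↔ G.Adj i j ∧ IsAncestor c j i ∧ ¬ IsParentLink α c i j := by
  rw [IsOutgoing, isNonTreeExt_iff, IsAncestor, IsParentLink]
  tauto

theorem IsParentLink.eq {v p : V} (h : IsParentLink α c v p) :
    pathOf c v = pathOf c p ++ [(α.idx p v : Label)] := h.2

theorem IsParentLink.isAncestor {v p : V} (h : IsParentLink α c v p) : IsAncestor c p v := by
  rw [IsAncestor, h.eq]
  exact List.prefix_append _ _

theorem IsAncestor.refl (v : V) : IsAncestor c v v := List.prefix_rfl

theorem IsAncestor.trans {u v w : V} (h : IsAncestor c u v) (h' : IsAncestor c v w) :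
    IsAncestor c u w := List.IsPrefix.trans h h'

/-- The ancestors of a node are totally ordered. -/
theorem IsAncestor.total {u v w : V} (h : IsAncestor c u w) (h' : IsAncestor c v w) :
    IsAncestor c u v ∨ IsAncestor c v u := List.prefix_or_prefix_of_prefix h h'

theorem IsParentLink.not_isAncestor {v p : V} (h : IsParentLink α c v p) :
    ¬ IsAncestor c v p := by
  intro h'
  have := List.IsPrefix.length_le h'
  rw [h.eq, List.length_append, List.length_singleton] at this
  omega

namespace IsDFSTree

variable (h : IsDFSTree α root (pathOf c))
include h

theorem exists_isParentLink {v : V} (hv : v ≠ root) : ∃ p, IsParentLink α c v p := by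
  obtain ⟨p, hp, hv⟩ := h.exists_parent v hv
  exact ⟨p, hp.symm, hv⟩

theorem pathOf_ne_nil (v : V) : pathOf c v ≠ [] := by
  by_cases hv : v = root
  · rw [hv, h.root_eq]
    simp
  · obtain ⟨p, hp⟩ := h.exists_isParentLink hv
    rw [hp.eq]
    simp

theorem not_isParentLink_root (p : V) : ¬ IsParentLink α c root p := by
  intro hp
  have hlen := congrArg List.length hp.eq
  have hpos := List.length_pos_iff.2 (h.pathOf_ne_nil p)
  rw [h.root_eq, List.length_append, List.length_singleton, List.length_singleton] at hlen
  omega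

theorem pathOf_injective : Function.Injective (pathOf c) := by
  suffices ∀ n u v, (pathOf c u).length = n → pathOf c u = pathOf c v → u = v from
    fun u v => this _ u v rfl
  intro n
  induction n with
  | zero => exact fun u v hu _ => absurd (List.length_eq_zero_iff.1 hu) (h.pathOf_ne_nil u)
  | succ n ih =>
    intro u v hn huv
    have hroot : ∀ {u v}, pathOf c u = pathOf c v → u = root → v = root := by
      intro u v huv hu
      by_contra hv
      obtain ⟨p, hp⟩ := h.exists_isParentLink hv
      have hlen := congrArg List.length huv
      have hpos := List.length_pos_iff.2 (h.pathOf_ne_nil p)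
      rw [hp.eq, hu, h.root_eq, List.length_append, List.length_singleton,
        List.length_singleton] at hlen
      omega
    by_cases hu : u = root
    · rw [hu, hroot huv hu]
    · obtain ⟨p, hp⟩ := h.exists_isParentLink hu
      obtain ⟨q, hq⟩ := h.exists_isParentLink fun hv => hu (hroot huv.symm hv)
      have heq := huv
      rw [hp.eq, hq.eq] at heq
      obtain ⟨h1, h2⟩ := List.append_inj' heq rfl
      have hpn : (pathOf c p).length = n := by
        rw [hp.eq, List.length_append, List.length_singleton] at hn
        omega
      obtain rfl := ih p q hpn h1
      exact α.idx_injective hp.1.symm hq.1.symm (by simpa using h2)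

theorem eq_of_isAncestor {u v : V} (huv : IsAncestor c u v) (hvu : IsAncestor c v u) : u = v :=
  h.pathOf_injective (List.IsPrefix.eq_of_length huv
    (le_antisymm (List.IsPrefix.length_le huv) (List.IsPrefix.length_le hvu)))

theorem isParentLink_unique {v p q : V} (hp : IsParentLink α c v p) (hq : IsParentLink α c v q) :
    p = q := by
  have := hp.eq.symm.trans hq.eq
  exact h.pathOf_injective (List.append_inj' this rfl).1

/-- There are no cross links: otherwise the end with the smaller word would offer the other end a
smaller word than its own. -/
theorem isAncestor_or_isAncestor {u v : V} (huv : G.Adj u v) :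
    IsAncestor c u v ∨ IsAncestor c v u := by
  have key : ∀ {u v}, G.Adj u v → pathOf c u < pathOf c v → IsAncestor c u v := by
    intro u v huv hlt
    by_contra hp
    have := PathWord.append_lt_append hlt hp [(α.idx u v : Label)] []
    rw [List.append_nil] at this
    exact absurd (h.le_append u v huv) (not_le_of_gt this)
  rcases lt_trichotomy (pathOf c u) (pathOf c v) with hlt | heq | hlt
  · exact Or.inl (key huv hlt)
  · exact Or.inl (by rw [IsAncestor, heq])
  · exact Or.inr (key huv.symm hlt)

theorem isAncestor_parent {a v p : V} (hav : IsAncestor c a v) (hne : a ≠ v)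
    (hp : IsParentLink α c v p) : IsAncestor c a p := by
  rw [IsAncestor, hp.eq, List.prefix_concat_iff, ← hp.eq] at hav
  exact hav.resolve_left fun h' => hne (h.pathOf_injective h')

theorem isAncestor_iff_of_isParentLink {a v p : V} (hp : IsParentLink α c v p) :
    IsAncestor c a p ↔ IsAncestor c a v ∧ a ≠ v :=
  ⟨fun hap => ⟨hap.trans hp.isAncestor, fun hav => hp.not_isAncestor (hav ▸ hap)⟩,
    fun hav => h.isAncestor_parent hav.1 hav.2 hp⟩

theorem eq_root_of_isAncestor_root {a : V} (ha : IsAncestor c a root) : a = root := by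
  refine h.pathOf_injective ?_
  rw [IsAncestor, h.root_eq] at ha
  rw [h.root_eq]
  exact ha.eq_of_length_le (List.length_pos_iff.2 (h.pathOf_ne_nil a))

/-- Induction along the tree paths that start at `a`. -/
theorem descendant_induction {a : V} {Q : V → Prop} (base : Q a)
    (step : ∀ v p, IsParentLink α c v p → IsAncestor c a p → Q p → Q v) {v : V}
    (hv : IsAncestor c a v) : Q v := by
  suffices ∀ n v, (pathOf c v).length = n → IsAncestor c a v → Q v from this _ v rfl hv
  intro n
  induction n with
  | zero => exact fun u hu _ => absurd (List.length_eq_zero_iff.1 hu) (h.pathOf_ne_nil u)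
  | succ n ih =>
    intro v hn hv
    by_cases hav : a = v
    · exact hav ▸ base
    · have hvr : v ≠ root := by
        rintro rfl
        exact hav (h.eq_root_of_isAncestor_root hv)
      obtain ⟨p, hp⟩ := h.exists_isParentLink hvr
      have hap := h.isAncestor_parent hv hav hp
      refine step v p hp hap (ih p ?_ hap)
      rw [hp.eq, List.length_append, List.length_singleton] at hn
      omega

theorem isAncestor_root (v : V) : IsAncestor c root v := by
  rw [IsAncestor, h.root_eq]
  suffices ∀ n v, (pathOf c v).length = n → [⊥] <+: pathOf c v from this _ v rfl
  intro n
  induction n with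
  | zero => exact fun u hu => absurd (List.length_eq_zero_iff.1 hu) (h.pathOf_ne_nil u)
  | succ n ih =>
    intro v hn
    by_cases hvr : v = root
    · rw [hvr, h.root_eq]
    · obtain ⟨p, hp⟩ := h.exists_isParentLink hvr
      rw [hp.eq]
      refine (ih p ?_).trans (List.prefix_append _ _)
      rw [hp.eq, List.length_append, List.length_singleton] at hn
      omega

theorem root_induction {Q : V → Prop} (base : Q root)
    (step : ∀ v p, IsParentLink α c v p → Q p → Q v) (v : V) : Q v :=
  h.descendant_induction base (fun v p hp _ => step v p hp) (h.isAncestor_root v)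

theorem exists_child_isAncestor {a v : V} (hav : IsAncestor c a v) (hne : a ≠ v) :
    ∃ u, IsParentLink α c u a ∧ IsAncestor c u v := by
  have : a = v ∨ ∃ u, IsParentLink α c u a ∧ IsAncestor c u v := by
    refine h.descendant_induction (Q := fun v => a = v ∨ ∃ u, IsParentLink α c u a ∧
      IsAncestor c u v) (Or.inl rfl) (fun v p hp _ hQ => Or.inr ?_) hav
    rcases hQ with rfl | ⟨u, hu, hup⟩
    · exact ⟨v, hp, .refl v⟩
    · exact ⟨u, hu, hup.trans hp.isAncestor⟩
  exact this.resolve_left hne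

theorem child_unique {a v u w : V} (hu : IsParentLink α c u a) (hw : IsParentLink α c w a)
    (huv : IsAncestor c u v) (hwv : IsAncestor c w v) : u = w := by
  refine h.pathOf_injective ((List.prefix_of_prefix_length_le huv hwv ?_).eq_of_length ?_) <;>
  · rw [hu.eq, hw.eq]
    simp

/-- A link that leaves the set of descendants of `v` is the parent link of `v` or bypasses it. -/
theorem mem_bypassing_of_adj {v x y : V} (hx : IsAncestor c v x) (hy : ¬ IsAncestor c v y)
    (hxy : G.Adj x y) : (x = v ∧ IsParentLink α c v y) ∨ (x, y) ∈ bypassing α c v := by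
  have hyx : IsAncestor c y x :=
    (h.isAncestor_or_isAncestor hxy).resolve_left fun h' => hy (hx.trans h')
  have hyv : IsAncestor c y v := (hyx.total hx).resolve_right hy
  have hne : y ≠ v := fun hyv => hy (hyv ▸ .refl y)
  have hvr : v ≠ root := by
    rintro rfl
    exact hne (h.eq_root_of_isAncestor_root hyv)
  obtain ⟨p, hp⟩ := h.exists_isParentLink hvr
  by_cases ht : IsParentLink α c x y
  · refine Or.inl ?_
    obtain rfl : v = x := by
      by_contra hvx
      exact hy (h.isAncestor_parent hx hvx ht)
    exact ⟨rfl, ht⟩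
  · exact Or.inr ⟨isOutgoing_iff.2 ⟨hxy, hyx, ht⟩, hx, p, hp, h.isAncestor_parent hyv hne hp⟩

theorem mem_bypassing_iff {v : V} {x : V × V} : x ∈ bypassing α c v ↔
    IsOutgoing α c x.1 x.2 ∧ IsAncestor c v x.1 ∧ IsAncestor c x.2 v ∧ x.2 ≠ v := by
  constructor
  · rintro ⟨h1, h2, p, hp, h3⟩
    exact ⟨h1, h2, (h.isAncestor_iff_of_isParentLink hp).1 h3⟩
  · rintro ⟨h1, h2, h3, h4⟩
    have hvr : v ≠ root := by
      rintro rfl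
      exact h4 (h.eq_root_of_isAncestor_root h3)
    obtain ⟨p, hp⟩ := h.exists_isParentLink hvr
    exact ⟨h1, h2, p, hp, h.isAncestor_parent h3 h4 hp⟩

theorem bypassing_root : bypassing α c root = ∅ :=
  Set.eq_empty_of_forall_notMem fun _ hx => by
    obtain ⟨-, -, p, hp, -⟩ := hx
    exact h.not_isParentLink_root p hp

/-! ### Least words of simple paths -/

omit h in
theorem walkWord_concat {u v w : V} (p : G.Walk u v) (hvw : G.Adj v w) :
    walkWord α (p.concat hvw) = walkWord α p ++ [(α.idx v w : Label)] := by
  simp [walkWord, SimpleGraph.Walk.darts_concat]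

omit h in
/-- A word determines the walk that it describes. -/
theorem mem_support_of_walkWord_prefix {u v w : V} (q : G.Walk u w) (p : G.Walk u v)
    (hqp : walkWord α q <+: walkWord α p) : w ∈ p.support := by
  induction q with
  | nil => exact p.start_mem_support
  | cons hux q ih =>
    cases p with
    | nil => simp [walkWord] at hqp
    | cons huy p =>
      simp only [walkWord, SimpleGraph.Walk.darts_cons, List.map_cons,
        List.cons_prefix_cons, true_and] at hqp
      obtain ⟨h1, h2⟩ := hqp
      obtain rfl := α.idx_injective hux huy (by simpa using h1)
      rw [SimpleGraph.Walk.support_cons]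
      exact List.mem_cons_of_mem _ (ih p (by simpa [walkWord] using h2))

theorem exists_isPath (v : V) : ∃ p : G.Walk root v, p.IsPath ∧ walkWord α p = pathOf c v := by
  suffices ∃ p : G.Walk root v, p.IsPath ∧ walkWord α p = pathOf c v ∧
      ∀ x ∈ p.support, IsAncestor c x v by
    obtain ⟨p, h1, h2, -⟩ := this
    exact ⟨p, h1, h2⟩
  refine h.root_induction (Q := fun v => ∃ p : G.Walk root v, p.IsPath ∧
    walkWord α p = pathOf c v ∧ ∀ x ∈ p.support, IsAncestor c x v) ?_ ?_ v
  · refine ⟨.nil, .nil, by rw [h.root_eq]; rfl, fun x hx => ?_⟩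
    rw [SimpleGraph.Walk.support_nil, List.mem_singleton] at hx
    exact hx ▸ .refl _
  · rintro v u hu ⟨p, hp, hpw, hps⟩
    refine ⟨p.concat hu.1.symm, hp.concat (fun hv => hu.not_isAncestor (hps v hv)) _, ?_, ?_⟩
    · rw [walkWord_concat, hpw, hu.eq]
    · intro x hx
      rw [SimpleGraph.Walk.support_concat, List.mem_append] at hx
      rcases hx with hx | hx
      · exact (hps x hx).trans hu.isAncestor
      · rw [List.mem_singleton.1 hx]
        exact .refl v

/-- As long as a simple path follows the tree, its word is that of its end. Where it leaves the tree
its word becomes larger at some position, and remains so. -/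
theorem eq_or_lt_walkWord {v : V} (p : G.Walk root v) (hp : p.IsPath) :
    pathOf c v = walkWord α p ∨
      (pathOf c v < walkWord α p ∧ ¬ pathOf c v <+: walkWord α p) := by
  suffices ∀ u v (p : G.Walk u v), p.IsPath → u = root → pathOf c v = walkWord α p ∨
      (pathOf c v < walkWord α p ∧ ¬ pathOf c v <+: walkWord α p) from this _ _ p hp rfl
  clear hp p v
  intro u v p
  induction p using SimpleGraph.Walk.concatRec with
  | Hnil =>
    rintro - rfl
    exact Or.inl (by rw [h.root_eq]; rfl)
  | @Hconcat u v w p hvw ih =>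
    rintro hp rfl
    rw [SimpleGraph.Walk.concat_isPath_iff] at hp
    have hpre : pathOf c w ≠ walkWord α (p.concat hvw) →
        ¬ pathOf c w <+: walkWord α (p.concat hvw) := by
      intro hne hpre
      rw [walkWord_concat, List.prefix_concat_iff, ← walkWord_concat p hvw] at hpre
      obtain ⟨q, -, hq⟩ := h.exists_isPath w
      refine hp.2 (mem_support_of_walkWord_prefix (α := α) q p ?_)
      rw [hq]
      exact hpre.resolve_left hne
    have hle := h.le_append v w hvw
    rcases ih hp.1 rfl with heq | ⟨hlt, hnp⟩
    · rw [heq, ← walkWord_concat p hvw] at hle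
      rcases hle.eq_or_lt with heq' | hlt'
      · exact Or.inl heq'
      · exact Or.inr ⟨hlt', hpre hlt'.ne⟩
    · have hlt' : pathOf c w < walkWord α (p.concat hvw) := by
        rw [walkWord_concat]
        exact hle.trans_lt (PathWord.append_lt_append hlt hnp _ _)
      exact Or.inr ⟨hlt', hpre hlt'.ne⟩

theorem isLeast_simplePathWords (v : V) : IsLeast (simplePathWords α root v) (pathOf c v) := by
  constructor
  · obtain ⟨p, hp, hpw⟩ := h.exists_isPath v
    exact ⟨p, hp, hpw.symm⟩
  · rintro w ⟨p, hp, rfl⟩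
    rcases h.eq_or_lt_walkWord p hp with heq | hlt
    · exact heq.le
    · exact hlt.1.le

end IsDFSTree

end Tree

section Count

variable {V : Type*} [Fintype V] [DecidableEq V] {G : SimpleGraph V} [DecidableRel G.Adj]
variable {α : PortNumbering G} {root : V} {c : Config G}

/-! ### The recursion for the numbers of bypassing edges -/

open Classical in
/-- What the link from `i` to `u` contributes to the count field of `i`, given the values `C` of the
count fields of the children of `i`. -/
noncomputable def contribution (α : PortNumbering G) (c : Config G) (C : V → ℤ) (i u : V) : ℤ :=
  if IsChildLink α c i u then C u
  else if IsIncoming α c i u then -1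
  else if IsOutgoing α c i u then 1
  else 0

theorem IsIncoming.not_isChildLink {i u : V} (h : IsIncoming α c i u) : ¬ IsChildLink α c i u := by
  rw [isChildLink_iff_isParentLink]
  exact (isOutgoing_iff.1 (isIncoming_iff_isOutgoing.1 h)).2.2

namespace IsDFSTree

variable (h : IsDFSTree α root (pathOf c))
include h

theorem not_isIncoming_of_isOutgoing {i u : V} (ho : IsOutgoing α c i u) :
    ¬ IsIncoming α c i u := by
  intro hi
  have hi := isOutgoing_iff.1 (isIncoming_iff_isOutgoing.1 hi)
  have ho := isOutgoing_iff.1 ho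
  exact ho.1.ne (h.eq_of_isAncestor hi.2.1 ho.2.1)

theorem not_isChildLink_of_isOutgoing {i u : V} (ho : IsOutgoing α c i u) :
    ¬ IsChildLink α c i u := by
  intro hi
  have ho := isOutgoing_iff.1 ho
  exact ho.1.ne (h.eq_of_isAncestor (isChildLink_iff_isParentLink.1 hi).isAncestor ho.2.1)

open Classical in
theorem contribution_eq (C : V → ℤ) (i u : V) : contribution α c C i u =
    (if IsChildLink α c i u then C u else 0) - (if IsOutgoing α c u i then 1 else 0) +
      (if IsOutgoing α c i u then 1 else 0) := by
  rw [← isIncoming_iff_isOutgoing]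
  by_cases ho : IsOutgoing α c i u
  · simp [contribution, ho, h.not_isIncoming_of_isOutgoing ho, h.not_isChildLink_of_isOutgoing ho]
  · by_cases hi : IsIncoming α c i u
    · simp [contribution, ho, hi, hi.not_isChildLink]
    · simp [contribution, ho, hi]

open Classical in
/-- The contribution of a single non-tree edge `(k, l)` to the recursion: an edge that bypasses the
parent link of `v` and does not start at `v` bypasses that of exactly one child of `v`, and an edge
that bypasses the parent link of a child of `v` ends at `v` or bypasses that of `v`. -/
theorem bypass_indicator {k l : V} (hkl : IsOutgoing α c k l) (v : V) :
    (if IsAncestor c v k ∧ IsAncestor c l v ∧ l ≠ v then (1 : ℤ) else 0) =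
      ∑ u, (if IsChildLink α c v u ∧ IsAncestor c u k ∧ IsAncestor c l u ∧ l ≠ u then (1 : ℤ)
        else 0) - (if l = v then 1 else 0) + (if k = v then 1 else 0) := by
  have hkl' := isOutgoing_iff.1 hkl
  have hchild : ∀ u, (IsChildLink α c v u ∧ IsAncestor c u k ∧ IsAncestor c l u ∧ l ≠ u) ↔
      (IsParentLink α c u v ∧ IsAncestor c u k) ∧ IsAncestor c l v := by
    intro u
    rw [isChildLink_iff_isParentLink]
    constructor
    · rintro ⟨h1, h2, h3⟩
      exact ⟨⟨h1, h2⟩, (h.isAncestor_iff_of_isParentLink h1).2 h3⟩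
    · rintro ⟨⟨h1, h2⟩, h3⟩
      exact ⟨h1, h2, (h.isAncestor_iff_of_isParentLink h1).1 h3⟩
  simp_rw [hchild]
  by_cases hvk : IsAncestor c v k
  · by_cases hkv : k = v
    · subst hkv
      have hno : ∀ u, ¬ ((IsParentLink α c u k ∧ IsAncestor c u k) ∧ IsAncestor c l k) :=
        fun u hu => hu.1.1.not_isAncestor hu.1.2
      rw [Finset.sum_eq_zero fun u _ => if_neg (hno u)]
      simp [hkl'.1.ne', IsAncestor.refl, hkl'.2.1]
    · obtain ⟨u, hu, huk⟩ := h.exists_child_isAncestor hvk (Ne.symm hkv)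
      rw [Finset.sum_eq_single u]
      · by_cases hlv : l = v
        · subst hlv
          simp [hu, huk, hkv, IsAncestor.refl]
        · simp [hu, huk, hkv, hlv, hvk]
      · intro w _ hwu
        rw [if_neg]
        rintro ⟨⟨h1, h2⟩, -⟩
        exact hwu (h.child_unique h1 hu h2 huk)
      · exact fun hu => absurd (Finset.mem_univ u) hu
  · have hlv : l ≠ v := fun hlv => hvk (hlv ▸ hkl'.2.1)
    have hkv : k ≠ v := fun hkv => hvk (hkv ▸ .refl k)
    have hno : ∀ u, ¬ ((IsParentLink α c u v ∧ IsAncestor c u k) ∧ IsAncestor c l v) :=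
      fun u hu => hvk (hu.1.1.isAncestor.trans hu.1.2)
    rw [Finset.sum_eq_zero fun u _ => if_neg (hno u)]
    simp [hlv, hkv, hvk]

open Classical in
theorem ncard_bypassing (v : V) : ((bypassing α c v).ncard : ℤ) =
    ∑ k, ∑ l, if IsOutgoing α c k l ∧ IsAncestor c v k ∧ IsAncestor c l v ∧ l ≠ v
      then (1 : ℤ) else 0 := by
  rw [← Fintype.sum_prod_type' fun k l => if IsOutgoing α c k l ∧ IsAncestor c v k ∧
    IsAncestor c l v ∧ l ≠ v then (1 : ℤ) else 0, Finset.sum_boole, Set.ncard_eq_toFinset_card']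
  congr 2
  ext x
  rw [Set.mem_toFinset, h.mem_bypassing_iff, Finset.mem_filter]
  simp

/-- The numbers of bypassing edges satisfy the recursion that the algorithm evaluates. -/
theorem ncard_bypassing_eq_sum (v : V) : ((bypassing α c v).ncard : ℤ) =
    ∑ u, contribution α c (fun u => ((bypassing α c u).ncard : ℤ)) v u := by
  classical
  have h1 : ∀ k l, (if IsOutgoing α c k l ∧ IsAncestor c v k ∧ IsAncestor c l v ∧ l ≠ v
      then (1 : ℤ) else 0) = ∑ u, (if IsChildLink α c v u ∧ IsOutgoing α c k l ∧ IsAncestor c u k ∧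
        IsAncestor c l u ∧ l ≠ u then (1 : ℤ) else 0) - (if IsOutgoing α c k l ∧ l = v then 1 else 0)
        + (if IsOutgoing α c k l ∧ k = v then 1 else 0) := by
    intro k l
    by_cases hkl : IsOutgoing α c k l
    · simpa only [hkl, true_and] using h.bypass_indicator hkl v
    · simp [hkl]
  have h2 : ∑ k, ∑ l, ∑ u, (if IsChildLink α c v u ∧ IsOutgoing α c k l ∧ IsAncestor c u k ∧
        IsAncestor c l u ∧ l ≠ u then (1 : ℤ) else 0) =
      ∑ u, if IsChildLink α c v u then ((bypassing α c u).ncard : ℤ) else 0 := by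
    rw [Finset.sum_congr rfl fun k _ => Finset.sum_comm, Finset.sum_comm]
    refine Finset.sum_congr rfl fun u _ => ?_
    by_cases hu : IsChildLink α c v u
    · simp only [hu, true_and, if_true, h.ncard_bypassing]
    · simp [hu]
  simp_rw [h.contribution_eq]
  rw [Finset.sum_add_distrib, Finset.sum_sub_distrib, ← h2, h.ncard_bypassing]
  simp_rw [h1, Finset.sum_add_distrib, Finset.sum_sub_distrib]
  congr 1
  · congr 1
    refine Finset.sum_congr rfl fun k _ => ?_
    rw [Finset.sum_eq_single v] <;> simp +contextual
  · rw [Finset.sum_eq_single v] <;> simp +contextual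

end IsDFSTree

/-! ### Nearest ancestors whose parent link is not bypassed -/

/-- `r` is the nearest ancestor of `v` (possibly `v` itself) whose parent link, if any, is not
bypassed by a non-tree edge. -/
def IsNearestUnbypassed (α : PortNumbering G) (c : Config G) (r v : V) : Prop :=
  IsAncestor c r v ∧ bypassing α c r = ∅ ∧
    ∀ x, IsAncestor c x v → IsAncestor c r x → bypassing α c x = ∅ → x = r

theorem isNearestUnbypassed_self {v : V} (hv : bypassing α c v = ∅)
    (h : IsDFSTree α root (pathOf c)) : IsNearestUnbypassed α c v v :=
  ⟨.refl v, hv, fun _ hx hx' _ => h.eq_of_isAncestor hx hx'⟩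

theorem IsNearestUnbypassed.of_parent {r p v : V} (hr : IsNearestUnbypassed α c r p)
    (hv : bypassing α c v ≠ ∅) (hp : IsParentLink α c v p) (h : IsDFSTree α root (pathOf c)) :
    IsNearestUnbypassed α c r v :=
  ⟨hr.1.trans hp.isAncestor, hr.2.1, fun x hx hx' hx0 =>
    hr.2.2 x (h.isAncestor_parent hx (fun hxv => hv (hxv ▸ hx0)) hp) hx' hx0⟩

theorem IsNearestUnbypassed.unique {r r' v : V} (hr : IsNearestUnbypassed α c r v)
    (hr' : IsNearestUnbypassed α c r' v) : r = r' := by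
  rcases hr.1.total hr'.1 with h | h
  · exact (hr.2.2 r' hr'.1 h hr'.2.1).symm
  · exact hr'.2.2 r hr.1 h hr.2.1

/-! ### Stabilization of the count fields -/

namespace IsScheduledBy

variable {N : ℕ} {e : ℕ → Config G} {σ : ℕ → V}

theorem eventually_localPath (h : IsScheduledBy α root N e σ) {i : V} (hr : i ≠ root)
    (hδ : 0 < G.degree i) {w : PathWord} (hw : ∀ᶠ t in atTop, pathOf (e t) i = w) :
    ∀ᶠ t in atTop, (e t i).path = w := by
  refine h.eventually_of_visits hr (Q := fun s => s.path = w) (h.visits_readOwnPath hr hδ) ?_ ?_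
  · filter_upwards [hw] with t ht hp
    simp only [localStep, nodeStep, hp]
    exact ht
  · filter_upwards [hw] with t ht hQ
    cases hp : (e t i).nodePC with
    | readOwnPath =>
      simp only [localStep, nodeStep, hp]
      exact ht
    | readOwnPathAgain =>
      simp only [localStep, nodeStep, hp]
      exact ht
    | bccLoop k => simp only [localStep, nodeStep, hp]; split_ifs <;> exact hQ
    | _ => simpa only [localStep, nodeStep, hp] using hQ

/-- If the counts of the children of `i` are stable, so is that of `i`. The invariant is that in
the iteration `j` of the second loop the local variable holds the contributions of the previous
links. -/
theorem eventually_countOf_eq_sum (h : IsScheduledBy α root N e σ) {i : V} (hr : i ≠ root)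
    (hδ : 0 < G.degree i) (hpath : ∀ᶠ t in atTop, pathOf (e t) = pathOf c) {C : V → ℤ}
    (hC : ∀ u, IsChildLink α c i u → ∀ᶠ t in atTop, countOf (e t) u = C u) :
    ∀ᶠ t in atTop, countOf (e t) i = ∑ j, contribution α c C i (α.nbr i j) := by
  have hpathi : ∀ u, ∀ᶠ t in atTop, pathOf (e t) u = pathOf c u := fun u =>
    hpath.mono fun t ht => congrFun ht u
  have hread : ∀ᶠ t in atTop, ∀ j, (e t i).readPath j = pathOf c (α.nbr i j) :=
    eventually_all.2 fun j => h.eventually_readPath hr j (P := (· = pathOf c (α.nbr i j)))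
      (hpathi _)
  have hlocal := h.eventually_localPath hr hδ (hpathi i)
  have hchild : ∀ᶠ t in atTop, ∀ u, IsChildLink α c i u → countOf (e t) u = C u :=
    eventually_all.2 fun u => by
      by_cases hu : IsChildLink α c i u
      · exact (hC u hu).mono fun t ht _ => ht
      · exact .of_forall fun t hu' => absurd hu' hu
  set S : ℕ → ℤ := fun n => ∑ k ∈ Finset.univ.filter fun k : Fin (G.degree i) => (k : ℕ) < n,
    contribution α c C i (α.nbr i k) with hS
  have hS0 : S 0 = 0 := by simp [hS]
  have hSsucc : ∀ j : Fin (G.degree i), S (j + 1) = S j + contribution α c C i (α.nbr i j) := by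
    intro j
    have : (Finset.univ.filter fun k : Fin (G.degree i) => (k : ℕ) < j + 1) =
        insert j (Finset.univ.filter fun k : Fin (G.degree i) => (k : ℕ) < j) := by
      ext k
      simp only [Finset.mem_filter, Finset.mem_univ, true_and, Finset.mem_insert, Fin.ext_iff]
      omega
    rw [hS]
    simp only
    rw [this, Finset.sum_insert (by simp), add_comm]
  have hSδ : S (G.degree i) = ∑ j, contribution α c C i (α.nbr i j) := by simp [hS]
  have hest : ∀ s : NodeState (G.degree i), s.nodePC = firstPort .countLoop .writeCount →
      s.count = 0 → (∀ j, s.nodePC = .countLoop j → s.count = S j) ∧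
        (s.nodePC = .writeCount → s.count = S (G.degree i)) := by
    intro s hs hs0
    rw [firstPort, dif_pos hδ] at hs
    rw [hs]
    refine ⟨fun j hj => ?_, fun hj => nomatch hj⟩
    injection hj with hj
    rw [hs0, ← hj]
    exact hS0.symm
  have hinv : ∀ᶠ t in atTop, (∀ j, (e t i).nodePC = .countLoop j → (e t i).count = S j) ∧
      ((e t i).nodePC = .writeCount → (e t i).count = S (G.degree i)) := by
    refine h.eventually_of_visits hr (Q := fun s => (∀ j, s.nodePC = .countLoop j → s.count = S j) ∧
      (s.nodePC = .writeCount → s.count = S (G.degree i))) (h.visits_readOwnPath hr hδ) ?_ ?_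
    · refine .of_forall fun t hp => hest _ ?_ ?_ <;> simp only [localStep, nodeStep, hp]
    · filter_upwards [hread, hlocal, hchild] with t hread hlocal hchild hQ
      cases hp : (e t i).nodePC with
      | readPath k =>
        simp only [localStep, nodeStep, hp, nextPort]
        split_ifs <;> simp
      | readOwnPath => refine hest _ ?_ ?_ <;> simp only [localStep, nodeStep, hp]
      | readOwnPathAgain =>
        simp only [localStep, nodeStep, hp, firstPort]
        split_ifs <;> simp
      | bccLoop k =>
        simp only [localStep, nodeStep, hp, nextPort, restart, firstPort]
        split_ifs <;> simp
      | writeReadBcc k =>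
        simp only [localStep, nodeStep, hp, nextPort, restart, firstPort]
        split_ifs <;> simp
      | writeOwnBcc =>
        simp only [localStep, nodeStep, hp, restart, firstPort]
        split_ifs
        simp
      | countLoop k =>
        have hcount : (localStep α N (e t) i).count = S (k + 1) := by
          have hadj := α.adj_nbr i k
          have hT : IsChildLink α c i (α.nbr i k) ↔
              IsTreeExt (e t i).path (α.idx i (α.nbr i k)) ((e t i).readPath k) := by
            rw [hread, hlocal]
            exact and_iff_right hadj
          have hI : IsIncoming α c i (α.nbr i k) ↔
              IsNonTreeExt (e t i).path (α.idx i (α.nbr i k)) ((e t i).readPath k) := by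
            rw [hread, hlocal]
            exact and_iff_right hadj
          have hO : IsOutgoing α c i (α.nbr i k) ↔
              IsNonTreeExt ((e t i).readPath k) (α.idx (α.nbr i k) i) (e t i).path := by
            rw [hread, hlocal]
            exact and_iff_right hadj
          classical
          have hcontr := if_congr hT (rfl : C (α.nbr i k) = _)
            (if_congr hI (rfl : (-1 : ℤ) = _) (if_congr hO (rfl : (1 : ℤ) = _) (rfl : (0 : ℤ) = _)))
          rw [hSsucc, ← hQ.1 k hp, contribution, hcontr]
          simp only [localStep, nodeStep, hp]
          split_ifs with h1 h2 h3
          · rw [← hchild (α.nbr i k) (hT.2 h1)]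
            rfl
          · rfl
          · rfl
          · rw [add_zero]
        have hpc : (localStep α N (e t) i).nodePC = nextPort .countLoop .writeCount k := by
          simp only [localStep, nodeStep, hp]
        rw [hcount, hpc, nextPort]
        split_ifs with hk
        · refine ⟨fun j hj => ?_, fun hj => nomatch hj⟩
          injection hj with hj
          rw [← hj]
        · refine ⟨nofun, fun _ => ?_⟩
          rw [show (k : ℕ) + 1 = G.degree i by omega]
      | _ => simp [localStep, nodeStep, hp]
  refine h.eventually_of_visits hr (Q := fun s => s.reg.count =
    ∑ j, contribution α c C i (α.nbr i j)) (h.visits_writeCount hr hδ) ?_ ?_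
  · filter_upwards [hinv] with t ht hp
    simp only [localStep, nodeStep, hp]
    rw [ht.2 hp, hSδ]
  · filter_upwards [hinv] with t ht hQ
    cases hp : (e t i).nodePC with
    | writeCount =>
      simp only [localStep, nodeStep, hp]
      rw [ht.2 hp, hSδ]
    | bccLoop k => simp only [localStep, nodeStep, hp]; split_ifs <;> exact hQ
    | _ => simpa only [localStep, nodeStep, hp] using hQ

/-- The count fields stabilize from the leaves of the tree upwards. -/
theorem eventually_countOf (h : IsScheduledBy α root N e σ) (hdeg : ∀ i ≠ root, 0 < G.degree i)
    (hc : IsDFSTree α root (pathOf c)) (hpath : ∀ᶠ t in atTop, pathOf (e t) = pathOf c) (v : V) :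
    ∀ᶠ t in atTop, countOf (e t) v = ((bypassing α c v).ncard : ℤ) := by
  obtain ⟨M, hM⟩ : ∃ M, ∀ v, (pathOf c v).length ≤ M :=
    ⟨_, fun v => Finset.le_sup (f := fun v => (pathOf c v).length) (Finset.mem_univ v)⟩
  induction hn : M - (pathOf c v).length using Nat.strong_induction_on generalizing v with
  | _ n ih =>
    by_cases hr : v = root
    · subst hr
      filter_upwards [h.eventually_countOf_root] with t ht
      rw [ht, hc.bypassing_root, Set.ncard_empty, Nat.cast_zero]
    · have := h.eventually_countOf_eq_sum hr (hdeg v hr) hpath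
        (C := fun u => ((bypassing α c u).ncard : ℤ)) fun u hu => ih _ ?_ u rfl
      · filter_upwards [this] with t ht
        rw [ht, hc.ncard_bypassing_eq_sum]
        refine Fintype.sum_of_injective _ (α.nbr_injective v) _ _ (fun u hu => ?_) fun j => rfl
        have hadj : ¬ G.Adj v u := fun hvu => hu (α.exists_nbr_eq hvu)
        simp [contribution, IsChildLink, IsIncoming, IsOutgoing, hadj]
      · have := congrArg List.length (isChildLink_iff_isParentLink.1 hu).eq
        have := hM u
        rw [List.length_append, List.length_singleton] at *
        omega

/-! ### Stabilization of the bcc fields -/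

theorem eventually_count_of_readOwnPathAgain (h : IsScheduledBy α root N e σ) {i : V}
    (hr : i ≠ root) (hδ : 0 < G.degree i) {C : ℤ} (hC : ∀ᶠ t in atTop, countOf (e t) i = C) :
    ∀ᶠ t in atTop, (e t i).nodePC = .readOwnPathAgain → (e t i).count = C := by
  refine h.eventually_of_visits hr (Q := fun s => s.nodePC = .readOwnPathAgain → s.count = C)
    (h.visits_readOwnCount hr hδ) ?_ ?_
  · filter_upwards [hC] with t ht hp _
    simp only [localStep, nodeStep, hp]
    exact ht
  · filter_upwards [hC] with t ht hQ
    cases hp : (e t i).nodePC with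
    | readOwnCount =>
      intro _
      simp only [localStep, nodeStep, hp]
      exact ht
    | _ =>
      simp only [localStep, nodeStep, hp, nextPort, restart, firstPort]
      first | (split_ifs <;> simp) | simp

/-- A non-root processor with the stable count `0` eventually publishes its own path. -/
theorem eventually_bccOf_eq_pathOf (h : IsScheduledBy α root N e σ) {i : V} (hr : i ≠ root)
    (hδ : 0 < G.degree i) {w : PathWord} (hw : ∀ᶠ t in atTop, pathOf (e t) i = w)
    (hC : ∀ᶠ t in atTop, countOf (e t) i = 0) : ∀ᶠ t in atTop, bccOf (e t) i = w := by
  have hcount := h.eventually_count_of_readOwnPathAgain hr hδ hC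
  have hlocal := h.eventually_localPath hr hδ hw
  have hinv : ∀ᶠ t in atTop, ∀ j, (e t i).nodePC ≠ .bccLoop j ∧ (e t i).nodePC ≠ .writeReadBcc j := by
    refine h.eventually_of_visits hr (Q := fun s => ∀ j, s.nodePC ≠ .bccLoop j ∧
      s.nodePC ≠ .writeReadBcc j) (h.visits_readOwnPathAgain hr hδ) ?_ ?_
    · filter_upwards [hcount] with t ht hp
      simp [localStep, nodeStep, hp, ht hp]
    · filter_upwards [hcount] with t ht hQ
      cases hp : (e t i).nodePC with
      | readOwnPathAgain => simp [localStep, nodeStep, hp, ht hp]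
      | bccLoop k => exact absurd hp (hQ k).1
      | writeReadBcc k => exact absurd hp (hQ k).2
      | _ =>
        simp only [localStep, nodeStep, hp, nextPort, restart, firstPort]
        first | (split_ifs <;> simp) | simp
  have hvisit : Visits e σ i .writeOwnBcc := by
    refine h.visits_next hr (h.visits_readOwnPathAgain hr hδ) ?_
    filter_upwards [hcount] with t ht hp
    simp [localStep, nodeStep, hp, ht hp]
  refine h.eventually_of_visits hr (Q := fun s => s.reg.bcc = w) hvisit ?_ ?_
  · filter_upwards [hlocal] with t ht hp
    simp only [localStep, nodeStep, hp]
    exact ht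
  · filter_upwards [hlocal, hinv] with t ht hinv hQ
    cases hp : (e t i).nodePC with
    | writeOwnBcc =>
      simp only [localStep, nodeStep, hp]
      exact ht
    | bccLoop k => exact absurd hp (hinv k).1
    | writeReadBcc k => exact absurd hp (hinv k).2
    | _ => simpa only [localStep, nodeStep, hp] using hQ

/-- A processor with a stable count other than `0` eventually publishes the stable value of its
parent. -/
theorem eventually_bccOf_eq_parent (h : IsScheduledBy α root N e σ) {i p : V} (hr : i ≠ root)
    (hc : IsDFSTree α root (pathOf c)) (hpath : ∀ᶠ t in atTop, pathOf (e t) = pathOf c)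
    (hp : IsParentLink α c i p) {C : ℤ} (hC : ∀ᶠ t in atTop, countOf (e t) i = C) (hC0 : C ≠ 0)
    {w : PathWord} (hw : ∀ᶠ t in atTop, bccOf (e t) p = w) :
    ∀ᶠ t in atTop, bccOf (e t) i = w := by
  obtain ⟨jp, hjp⟩ := α.exists_nbr_eq hp.1
  have hδ : 0 < G.degree i := jp.pos
  have hpathi : ∀ u, ∀ᶠ t in atTop, pathOf (e t) u = pathOf c u := fun u =>
    hpath.mono fun t ht => congrFun ht u
  have hread : ∀ᶠ t in atTop, ∀ j, (e t i).readPath j = pathOf c (α.nbr i j) :=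
    eventually_all.2 fun j => h.eventually_readPath hr j (P := (· = pathOf c (α.nbr i j)))
      (hpathi _)
  have hlocal := h.eventually_localPath hr hδ (hpathi i)
  have hcount := h.eventually_count_of_readOwnPathAgain hr hδ hC
  -- the test for the parent link succeeds at the port `jp` only
  have htest : ∀ᶠ t in atTop, ∀ j, IsTreeExt ((e t i).readPath j) (α.idx (α.nbr i j) i)
      (e t i).path ↔ j = jp := by
    filter_upwards [hread, hlocal] with t hread hlocal j
    rw [hread, hlocal]
    constructor
    · intro hj
      exact α.nbr_injective i ((hc.isParentLink_unique ⟨α.adj_nbr i j, hj⟩ hp).trans hjp.symm)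
    · rintro rfl
      rw [hjp]
      exact hp.2
  have hinv : ∀ᶠ t in atTop, (e t i).nodePC ≠ .writeOwnBcc ∧
      ∀ j, (e t i).nodePC = .writeReadBcc j → (e t i).readBcc j = w := by
    refine h.eventually_of_visits hr (Q := fun s => s.nodePC ≠ .writeOwnBcc ∧
      ∀ j, s.nodePC = .writeReadBcc j → s.readBcc j = w) (h.visits_readOwnPathAgain hr hδ) ?_ ?_
    · filter_upwards [hcount] with t ht hp
      simp [localStep, nodeStep, hp, ht hp, hC0, firstPort, hδ]
    · filter_upwards [hcount, htest, hw] with t ht htest hw hQ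
      cases hp : (e t i).nodePC with
      | readOwnPathAgain => simp [localStep, nodeStep, hp, ht hp, hC0, firstPort, hδ]
      | writeOwnBcc => exact absurd hp hQ.1
      | bccLoop k =>
        simp only [localStep, nodeStep, hp, htest, nextPort, restart, firstPort]
        split_ifs with hk
        · refine ⟨nofun, fun j hj => ?_⟩
          injection hj with hj
          subst hj hk
          simp only [Function.update_self]
          rw [hjp]
          exact hw
        all_goals simp
      | _ =>
        simp only [localStep, nodeStep, hp, nextPort, restart, firstPort]
        first | (split_ifs <;> simp) | simp
  have hvisit : Visits e σ i (.writeReadBcc jp) := by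
    refine h.visits_next hr (p := .bccLoop jp) (h.visits_body (done := restart _) hr hδ
      (h.visits_next hr (h.visits_readOwnPathAgain hr hδ) ?_) jp fun k hk => ?_) ?_
    · filter_upwards [hcount] with t ht hp
      simp only [localStep, nodeStep, hp, ht hp, hC0, if_false]
    · filter_upwards [htest] with t htest hp
      simp only [localStep, nodeStep, hp, htest, hk.ne, if_false]
    · filter_upwards [htest] with t htest hp
      simp only [localStep, nodeStep, hp, htest, if_true]
  refine h.eventually_of_visits hr (Q := fun s => s.reg.bcc = w) hvisit ?_ ?_
  · filter_upwards [hinv] with t hinv hp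
    simp only [localStep, nodeStep, hp]
    exact hinv.2 jp hp
  · filter_upwards [hinv] with t hinv hQ
    cases hp : (e t i).nodePC with
    | writeOwnBcc => exact absurd hp hinv.1
    | bccLoop k => simp only [localStep, nodeStep, hp]; split_ifs <;> exact hQ
    | writeReadBcc k =>
      simp only [localStep, nodeStep, hp]
      exact hinv.2 k hp
    | _ => simpa only [localStep, nodeStep, hp] using hQ

/-- The bcc fields stabilize from the root of the tree downwards. -/
theorem exists_eventually_bccOf (h : IsScheduledBy α root N e σ)
    (hdeg : ∀ i ≠ root, 0 < G.degree i) (hc : IsDFSTree α root (pathOf c))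
    (hpath : ∀ᶠ t in atTop, pathOf (e t) = pathOf c) (v : V) :
    ∃ r, IsNearestUnbypassed α c r v ∧ ∀ᶠ t in atTop, bccOf (e t) v = pathOf c r := by
  refine hc.root_induction (Q := fun v => ∃ r, IsNearestUnbypassed α c r v ∧
    ∀ᶠ t in atTop, bccOf (e t) v = pathOf c r) ?_ ?_ v
  · refine ⟨root, isNearestUnbypassed_self hc.bypassing_root hc, ?_⟩
    rw [hc.root_eq]
    exact h.eventually_bccOf_root
  · rintro v p hp ⟨r, hr, hbcc⟩
    have hv : v ≠ root := by
      rintro rfl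
      exact hc.not_isParentLink_root p hp
    have hcount := h.eventually_countOf hdeg hc hpath v
    by_cases h0 : bypassing α c v = ∅
    · refine ⟨v, isNearestUnbypassed_self h0 hc, h.eventually_bccOf_eq_pathOf hv (hdeg v hv)
        (hpath.mono fun t ht => congrFun ht v) ?_⟩
      simpa [h0] using hcount
    · refine ⟨r, hr.of_parent h0 hp hc, h.eventually_bccOf_eq_parent hv hc hpath hp hcount ?_ hbcc⟩
      rwa [Nat.cast_ne_zero, Ne, Set.ncard_eq_zero]

end IsScheduledBy

end Count

/-! ### Bridge-connected components of a graph -/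

section Components

variable {V : Type*} {G : SimpleGraph V}

/-- The graph without its bridges. -/
def withoutBridges (G : SimpleGraph V) : SimpleGraph V := G.deleteEdges {e | G.IsBridge e}

theorem withoutBridges_adj {u v : V} :
    (withoutBridges G).Adj u v ↔ G.Adj u v ∧ ¬ G.IsBridge s(u, v) := by
  simp [withoutBridges, SimpleGraph.deleteEdges_adj]

theorem withoutBridges_le : withoutBridges G ≤ G := SimpleGraph.deleteEdges_le _

/-- The subgraph of `G` formed by the links that are no bridges and the nodes that are reachable
from `v` over such links. -/
def componentWithoutBridges (G : SimpleGraph V) (v : V) : G.Subgraph where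
  verts := {w | (withoutBridges G).Reachable v w}
  Adj a b := (withoutBridges G).Adj a b ∧ (withoutBridges G).Reachable v a
  adj_sub h := withoutBridges_le h.1
  edge_vert h := h.2
  symm := ⟨fun _ _ h => ⟨h.1.symm, h.2.trans h.1.reachable⟩⟩

theorem componentWithoutBridges_connected (v : V) : (componentWithoutBridges G v).Connected := by
  have hv : v ∈ (componentWithoutBridges G v).verts := SimpleGraph.Reachable.refl v
  have key : ∀ w (hw : w ∈ (componentWithoutBridges G v).verts),
      (componentWithoutBridges G v).coe.Reachable ⟨v, hv⟩ ⟨w, hw⟩ := by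
    rintro w ⟨p⟩
    suffices ∀ u w (_ : (withoutBridges G).Walk u w)
        (hu : u ∈ (componentWithoutBridges G v).verts)
        (hw : w ∈ (componentWithoutBridges G v).verts),
        (componentWithoutBridges G v).coe.Reachable ⟨u, hu⟩ ⟨w, hw⟩ from this v w p hv ⟨p⟩
    intro u w p
    induction p with
    | nil => exact fun _ _ => SimpleGraph.Reachable.refl _
    | @cons a b d hab p ih =>
      intro ha hd
      have hb : b ∈ (componentWithoutBridges G v).verts :=
        SimpleGraph.Reachable.trans ha hab.reachable
      exact (SimpleGraph.Adj.reachable (show (componentWithoutBridges G v).coe.Adj ⟨a, ha⟩ ⟨b, hb⟩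
        from ⟨hab, ha⟩)).trans (ih hb hd)
  exact SimpleGraph.Subgraph.connected_iff'.2 (SimpleGraph.connected_iff _ |>.2
    ⟨fun a b => (key a.1 a.2).symm.trans (key b.1 b.2), ⟨⟨v, hv⟩⟩⟩)

theorem not_isBridge_of_mem_componentWithoutBridges {v : V} {e : Sym2 V}
    (he : e ∈ (componentWithoutBridges G v).edgeSet) : ¬ G.IsBridge e := by
  induction e with
  | _ a b => exact (withoutBridges_adj.1 he.1).2

theorem le_componentWithoutBridges {H : G.Subgraph} (hH : H.Connected)
    (hb : ∀ e ∈ H.edgeSet, ¬ G.IsBridge e) {v : V} (hv : v ∈ H.verts) :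
    H ≤ componentWithoutBridges G v := by
  have hadj : ∀ {a b}, H.Adj a b → (withoutBridges G).Adj a b := fun hab =>
    withoutBridges_adj.2 ⟨H.adj_sub hab, hb _ hab⟩
  have hverts : H.verts ⊆ (componentWithoutBridges G v).verts := fun w hw =>
    (hH.coe.preconnected ⟨v, hv⟩ ⟨w, hw⟩).map
      (⟨Subtype.val, hadj⟩ : H.coe →g withoutBridges G)
  exact ⟨hverts, fun a b hab => ⟨hadj hab, hverts (H.edge_vert hab)⟩⟩

/-- The bridge-connected components are the classes of mutual reachability over links that are no
bridges. -/
theorem isBridgeConnectedComponent_iff {S : Set V} : IsBridgeConnectedComponent G S ↔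
    ∃ v, S = {w | (withoutBridges G).Reachable v w} := by
  constructor
  · rintro ⟨H, ⟨⟨hconn, hb⟩, hmax⟩, rfl⟩
    obtain ⟨⟨v, hv⟩⟩ := hconn.coe.nonempty
    have hle := le_componentWithoutBridges hconn hb hv
    exact ⟨v, Set.Subset.antisymm hle.1 (hmax ⟨componentWithoutBridges_connected v,
      fun _ => not_isBridge_of_mem_componentWithoutBridges⟩ hle).1⟩
  · rintro ⟨v, rfl⟩
    refine ⟨componentWithoutBridges G v, ⟨⟨componentWithoutBridges_connected v,
      fun _ => not_isBridge_of_mem_componentWithoutBridges⟩, fun K hK hle => ?_⟩, rfl⟩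
    exact le_componentWithoutBridges hK.1 hK.2 (hle.1 (SimpleGraph.Reachable.refl v))

end Components

section Connectivity

variable {V : Type*} [Fintype V] [DecidableEq V] {G : SimpleGraph V} [DecidableRel G.Adj]
variable {α : PortNumbering G} {root : V} {c : Config G}

/-! ### Bridges and non-tree edges -/

theorem IsParentLink.eq_of_sym2_eq {x p v u : V} (hx : IsParentLink α c x p)
    (hv : IsParentLink α c v u) (he : s(p, x) = s(u, v)) : p = u ∧ x = v := by
  rcases Sym2.eq_iff.1 he with he | ⟨rfl, rfl⟩
  · exact he
  · exact absurd hx.isAncestor hv.not_isAncestor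

namespace IsDFSTree

variable (h : IsDFSTree α root (pathOf c))
include h

theorem link_cases {u v : V} (huv : G.Adj u v) : IsParentLink α c u v ∨ IsChildLink α c u v ∨
    IsOutgoing α c u v ∨ IsIncoming α c u v := by
  rw [isChildLink_iff_isParentLink, isIncoming_iff_isOutgoing, isOutgoing_iff, isOutgoing_iff]
  have := h.isAncestor_or_isAncestor huv
  have := huv.symm
  tauto

/-- The tree path from `a` to its descendant `k` lies in every graph that contains its links. -/
theorem reachable_of_isAncestor {H : SimpleGraph V} {a k : V} (hak : IsAncestor c a k)
    (hH : ∀ x p, IsParentLink α c x p → IsAncestor c a p → IsAncestor c x k → H.Adj p x) :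
    H.Reachable a k := by
  refine h.descendant_induction (Q := fun x => IsAncestor c x k → H.Reachable a x)
    (fun _ => .refl a) (fun x p hp hap ih hxk => ?_) hak (.refl k)
  exact (ih (hp.isAncestor.trans hxk)).trans (hH x p hp hap hxk).reachable

theorem isBridge_of_bypassing_eq_empty {u v : V} (hv : IsParentLink α c v u)
    (h0 : bypassing α c v = ∅) : G.IsBridge s(u, v) := by
  rw [SimpleGraph.isBridge_iff]
  intro hr
  obtain ⟨p⟩ := hr.symm
  obtain ⟨d, -, hd1, hd2⟩ := p.exists_boundary_dart {x | IsAncestor c v x} (.refl v)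
    hv.not_isAncestor
  have hd := SimpleGraph.deleteEdges_adj.1 d.adj
  rcases h.mem_bypassing_of_adj hd1 hd2 hd.1 with ⟨h1, h2⟩ | hmem
  · refine hd.2 ?_
    rw [h1, h.isParentLink_unique h2 hv, Sym2.eq_swap]
    rfl
  · rw [h0] at hmem
    exact hmem

/-- A non-tree edge that bypasses the parent link of `v` closes a cycle through this link. -/
theorem not_isBridge_of_mem_bypassing {u v : V} (hv : IsParentLink α c v u) {x : V × V}
    (hx : x ∈ bypassing α c v) : ¬ G.IsBridge s(u, v) := by
  obtain ⟨k, l⟩ := x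
  obtain ⟨hkl, hvk, hlv, hne⟩ := h.mem_bypassing_iff.1 hx
  obtain ⟨hadj, hlk, hnp⟩ := isOutgoing_iff.1 hkl
  have hlu : IsAncestor c l u := h.isAncestor_parent hlv hne hv
  rw [SimpleGraph.isBridge_iff, not_not]
  have h1 : (G.deleteEdges {s(u, v)}).Reachable v k := by
    refine h.reachable_of_isAncestor hvk fun x p hp hvp _ =>
      SimpleGraph.deleteEdges_adj.2 ⟨hp.1.symm, fun he => ?_⟩
    obtain ⟨rfl, rfl⟩ := hp.eq_of_sym2_eq hv he
    exact hp.not_isAncestor hvp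
  have h2 : (G.deleteEdges {s(u, v)}).Reachable l u := by
    refine h.reachable_of_isAncestor hlu fun x p hp _ hxu =>
      SimpleGraph.deleteEdges_adj.2 ⟨hp.1.symm, fun he => ?_⟩
    obtain ⟨rfl, rfl⟩ := hp.eq_of_sym2_eq hv he
    exact hp.not_isAncestor hxu
  have h3 : (G.deleteEdges {s(u, v)}).Adj k l := by
    refine SimpleGraph.deleteEdges_adj.2 ⟨hadj, fun he => ?_⟩
    rcases Sym2.eq_iff.1 he with ⟨rfl, rfl⟩ | ⟨rfl, rfl⟩
    · exact hne rfl
    · exact hnp hv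
  exact ((h1.trans h3.reachable).trans h2).symm

/-- A non-tree edge closes a cycle with the tree path between its ends. -/
theorem not_isBridge_of_isOutgoing {k l : V} (hkl : IsOutgoing α c k l) :
    ¬ G.IsBridge s(k, l) := by
  obtain ⟨-, hlk, hnp⟩ := isOutgoing_iff.1 hkl
  rw [SimpleGraph.isBridge_iff, not_not]
  refine (h.reachable_of_isAncestor hlk fun x p hp _ _ =>
    SimpleGraph.deleteEdges_adj.2 ⟨hp.1.symm, fun he => ?_⟩).symm
  rcases Sym2.eq_iff.1 he with ⟨rfl, rfl⟩ | ⟨rfl, rfl⟩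
  · exact hp.not_isAncestor hlk
  · exact hnp hp

theorem isBridge_iff_of_isParentLink {u v : V} (hv : IsParentLink α c v u) :
    G.IsBridge s(u, v) ↔ bypassing α c v = ∅ := by
  refine ⟨fun hb => ?_, h.isBridge_of_bypassing_eq_empty hv⟩
  by_contra hne
  obtain ⟨x, hx⟩ := Set.nonempty_iff_ne_empty.2 hne
  exact h.not_isBridge_of_mem_bypassing hv hx hb

theorem isBridge_iff {u v : V} (huv : G.Adj u v) : G.IsBridge s(u, v) ↔
    (IsChildLink α c u v ∧ bypassing α c v = ∅) ∨
      (IsParentLink α c u v ∧ bypassing α c u = ∅) := by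
  constructor
  · intro hb
    rcases h.link_cases huv with hl | hl | hl | hl
    · exact Or.inr ⟨hl, (h.isBridge_iff_of_isParentLink hl).1 (Sym2.eq_swap ▸ hb)⟩
    · exact Or.inl ⟨hl, (h.isBridge_iff_of_isParentLink (isChildLink_iff_isParentLink.1 hl)).1 hb⟩
    · exact absurd hb (h.not_isBridge_of_isOutgoing hl)
    · rw [Sym2.eq_swap] at hb
      exact absurd hb (h.not_isBridge_of_isOutgoing (isIncoming_iff_isOutgoing.1 hl))
  · rintro (⟨hl, h0⟩ | ⟨hl, h0⟩)
    · exact h.isBridge_of_bypassing_eq_empty (isChildLink_iff_isParentLink.1 hl) h0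
    · rw [Sym2.eq_swap]
      exact h.isBridge_of_bypassing_eq_empty hl h0

/-! ### Articulation points -/

omit h in
/-- Removing `v` disconnects the graph if every link from a set `D` to its complement ends
at `v`. -/
theorem isArticulationPoint_of_separation {v a b : V} (D : Set V) (ha : a ∈ D) (hb : b ∉ D)
    (hav : a ≠ v) (hbv : b ≠ v) (hD : ∀ x ∈ D, ∀ y ∉ D, G.Adj x y → y = v) :
    IsArticulationPoint G v := by
  intro hc
  obtain ⟨p⟩ := hc ⟨a, hav⟩ ⟨b, hbv⟩
  obtain ⟨d, -, hd1, hd2⟩ := p.exists_boundary_dart (Subtype.val ⁻¹' D) ha hb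
  exact d.snd.2 (hD _ hd1 _ hd2 d.adj)

theorem reachable_induce_of_isAncestor {v a k : V} (hak : IsAncestor c a k)
    (hv : ∀ x, IsAncestor c a x → IsAncestor c x k → x ≠ v) (ha : a ∈ ({v}ᶜ : Set V))
    (hk : k ∈ ({v}ᶜ : Set V)) : (G.induce {v}ᶜ).Reachable ⟨a, ha⟩ ⟨k, hk⟩ := by
  have := h.descendant_induction (Q := fun x => IsAncestor c x k →
    ∃ hx : x ∈ ({v}ᶜ : Set V), (G.induce {v}ᶜ).Reachable ⟨a, ha⟩ ⟨x, hx⟩)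
    (fun _ => ⟨ha, .refl _⟩) (fun x p hp hap ih hxk => ?_) hak (.refl k)
  · exact this.2
  · obtain ⟨hpv, hr⟩ := ih (hp.isAncestor.trans hxk)
    refine ⟨hv x (hap.trans hp.isAncestor) hxk, hr.trans (SimpleGraph.Adj.reachable ?_)⟩
    exact hp.1.symm

/-- If no non-tree edge leads from the descendants of the child `u` of `v` to a proper ancestor of
`v`, the removal of `v` cuts them off. If there is such an edge for every child of `v`, all nodes
remain connected to the root. -/
theorem isArticulationPoint_iff {v : V} (hvr : v ≠ root) : IsArticulationPoint G v ↔
    ∃ u, IsParentLink α c u v ∧ ∀ x ∈ bypassing α c u, x.2 = v := by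
  constructor
  · contrapose!
    intro hall hart
    refine hart ?_
    have hroot : ∀ x (hx : x ∈ ({v}ᶜ : Set V)), ¬ IsAncestor c v x →
        (G.induce {v}ᶜ).Reachable ⟨root, hvr.symm⟩ ⟨x, hx⟩ := fun x hx hvx =>
      h.reachable_induce_of_isAncestor (h.isAncestor_root x)
        (fun y _ (hyx : IsAncestor c y x) hyv => hvx (by rwa [hyv] at hyx)) _ _
    have hreach : ∀ x (hx : x ∈ ({v}ᶜ : Set V)),
        (G.induce {v}ᶜ).Reachable ⟨root, hvr.symm⟩ ⟨x, hx⟩ := by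
      intro x hx
      by_cases hvx : IsAncestor c v x
      · obtain ⟨u, hu, hux⟩ := h.exists_child_isAncestor hvx (Ne.symm hx)
        obtain ⟨⟨k, l⟩, hmem, hlv⟩ := hall u hu
        obtain ⟨hkl, huk, hlu, hne⟩ := h.mem_bypassing_iff.1 hmem
        have hlv' : IsAncestor c l v := h.isAncestor_parent hlu hne hu
        have huv : ∀ y, IsAncestor c u y → y ≠ v := fun y huy hyv => hu.not_isAncestor (hyv ▸ huy)
        have h1 := hroot l hlv fun hvl => hlv (h.eq_of_isAncestor hlv' hvl)
        have h2 : (G.induce {v}ᶜ).Adj ⟨l, hlv⟩ ⟨k, huv k huk⟩ := (isOutgoing_iff.1 hkl).1.symm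
        have h3 := h.reachable_induce_of_isAncestor huk (fun y huy _ => huv y huy)
          (huv u (.refl u)) (huv k huk)
        have h4 := h.reachable_induce_of_isAncestor hux (fun y huy _ => huv y huy)
          (huv u (.refl u)) hx
        exact ((h1.trans h2.reachable).trans h3.symm).trans h4
      · exact hroot x hx hvx
    exact fun x y => (hreach x.1 x.2).symm.trans (hreach y.1 y.2)
  · rintro ⟨u, hu, hby⟩
    have huv : u ≠ v := hu.1.ne
    refine isArticulationPoint_of_separation {x | IsAncestor c u x} (a := u) (b := root) (.refl u)
      (fun hur => ?_) huv hvr.symm fun x hx y hy hxy => ?_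
    · exact h.not_isParentLink_root v (h.eq_root_of_isAncestor_root hur ▸ hu)
    · rcases h.mem_bypassing_of_adj hx hy hxy with ⟨-, h2⟩ | hmem
      · exact h.isParentLink_unique h2 hu
      · exact hby _ hmem

theorem isArticulationPoint_root_iff : IsArticulationPoint G root ↔
    ∃ u w, u ≠ w ∧ IsParentLink α c u root ∧ IsParentLink α c w root := by
  constructor
  · contrapose!
    intro hall hart
    refine hart fun x y => ?_
    obtain ⟨u, hu, hux⟩ := h.exists_child_isAncestor (h.isAncestor_root x.1) (Ne.symm x.2)
    obtain ⟨w, hw, hwy⟩ := h.exists_child_isAncestor (h.isAncestor_root y.1) (Ne.symm y.2)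
    obtain rfl : u = w := by
      by_contra huw
      exact hall u w huw hu hw
    have hur : ∀ z, IsAncestor c u z → z ≠ root := fun z huz hz => hu.not_isAncestor (hz ▸ huz)
    exact (h.reachable_induce_of_isAncestor hux (fun z hz _ => hur z hz) (hur u (.refl u))
      x.2).symm.trans (h.reachable_induce_of_isAncestor hwy (fun z hz _ => hur z hz)
      (hur u (.refl u)) y.2)
  · rintro ⟨u, w, huw, hu, hw⟩
    refine isArticulationPoint_of_separation {x | IsAncestor c u x} (a := u) (b := w) (.refl u)
      (fun huw' => huw (h.child_unique hu hw huw' (.refl w))) hu.1.ne hw.1.ne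
      fun x hx y hy hxy => ?_
    rcases h.mem_bypassing_of_adj hx hy hxy with ⟨-, h2⟩ | hmem
    · exact h.isParentLink_unique h2 hu
    · obtain ⟨-, -, hyu, hne⟩ := h.mem_bypassing_iff.1 hmem
      exact h.eq_root_of_isAncestor_root (h.isAncestor_parent hyu hne hu)

/-- For a child `u` of `v`, the edges from descendants of `u` to `v` are among those that bypass the
link between `u` and `v`, and so the numbers agree only if there are no others. -/
theorem ncard_bypassing_eq_incomingFrom_iff {u v : V} (hu : IsParentLink α c u v) :
    (bypassing α c u).ncard = incomingFrom α c u v ↔ ∀ x ∈ bypassing α c u, x.2 = v := by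
  have himage : (fun l => (l, v)) '' {l | IsIncoming α c v l ∧ IsAncestor c u l} =
      {x ∈ bypassing α c u | x.2 = v} := by
    ext ⟨k, l⟩
    simp only [Set.mem_image, Set.mem_ofPred_eq, Prod.mk.injEq]
    constructor
    · rintro ⟨_, ⟨hin, huk⟩, rfl, rfl⟩
      exact ⟨h.mem_bypassing_iff.2 ⟨isIncoming_iff_isOutgoing.1 hin, huk, hu.isAncestor, hu.1.ne'⟩,
        rfl⟩
    · rintro ⟨hmem, rfl⟩
      obtain ⟨hkl, huk, -, -⟩ := h.mem_bypassing_iff.1 hmem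
      exact ⟨k, ⟨isIncoming_iff_isOutgoing.2 hkl, huk⟩, rfl, rfl⟩
  have hcard : incomingFrom α c u v = {x ∈ bypassing α c u | x.2 = v}.ncard := by
    rw [← himage, Set.ncard_image_of_injective _ fun a b hab => congrArg Prod.fst hab]
    rfl
  rw [hcard]
  constructor
  · intro heq x hx
    rw [← Set.eq_of_subset_of_ncard_le (Set.sep_subset _ _) heq.le] at hx
    exact hx.2
  · intro hall
    rw [Set.sep_eq_self_iff_mem_true.2 hall]

/-! ### Representative nodes -/

theorem nearestUnbypassed_eq_of_adj {rep : V → V} (hrep : ∀ v, IsNearestUnbypassed α c (rep v) v)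
    {a b : V} (hab : (withoutBridges G).Adj a b) : rep a = rep b := by
  have hparent : ∀ {v p}, IsParentLink α c v p → ¬ G.IsBridge s(p, v) → rep v = rep p :=
    fun {v p} hp hb => (hrep v).unique ((hrep p).of_parent
      (fun h0 => hb (h.isBridge_of_bypassing_eq_empty hp h0)) hp h)
  have hout : ∀ {k l}, IsOutgoing α c k l → rep k = rep l := by
    intro k l hkl
    refine (hrep k).unique ?_
    refine h.descendant_induction (Q := fun x => IsAncestor c x k →
      IsNearestUnbypassed α c (rep l) x) (fun _ => hrep l) (fun x p hp hlp ih hxk => ?_)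
      (isOutgoing_iff.1 hkl).2.1 (.refl k)
    refine (ih (hp.isAncestor.trans hxk)).of_parent (fun h0 => ?_) hp h
    -- the edge `(k, l)` bypasses all links of the tree path from `l` to `k`
    have hmem : (k, l) ∈ bypassing α c x := ⟨hkl, hxk, p, hp, hlp⟩
    rw [h0] at hmem
    exact hmem
  obtain ⟨hadj, hb⟩ := withoutBridges_adj.1 hab
  rcases h.link_cases hadj with hl | hl | hl | hl
  · exact hparent hl (Sym2.eq_swap ▸ hb)
  · exact (hparent (isChildLink_iff_isParentLink.1 hl) hb).symm
  · exact hout hl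
  · exact (hout (isIncoming_iff_isOutgoing.1 hl)).symm

/-- Reachability without bridges preserves the nearest ancestor whose parent link is not bypassed, and
every node is reachable from this ancestor over the tree links in between, which are bypassed. -/
theorem reachable_withoutBridges_iff {rep : V → V}
    (hrep : ∀ v, IsNearestUnbypassed α c (rep v) v) {u v : V} :
    (withoutBridges G).Reachable u v ↔ rep u = rep v := by
  constructor
  · rintro ⟨p⟩
    induction p with
    | nil => rfl
    | cons hab _ ih => exact (h.nearestUnbypassed_eq_of_adj hrep hab).trans ih
  · have key : ∀ v, (withoutBridges G).Reachable (rep v) v := by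
      intro v
      refine h.reachable_of_isAncestor (hrep v).1 fun x p hp hrp hxv => ?_
      refine withoutBridges_adj.2 ⟨hp.1.symm, fun hb => ?_⟩
      have hx := (hrep v).2.2 x hxv (hrp.trans hp.isAncestor)
        ((h.isBridge_iff_of_isParentLink hp).1 hb)
      exact hp.not_isAncestor (hx ▸ hrp)
    intro huv
    exact (key u).symm.trans (huv ▸ key v)

theorem exists_eq_fiber {rep : V → V} (hrep : ∀ v, IsNearestUnbypassed α c (rep v) v) {S : Set V}
    (hS : IsBridgeConnectedComponent G S) :
    ∃ r, rep r = r ∧ S = {v | rep v = r} := by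
  obtain ⟨v, rfl⟩ := isBridgeConnectedComponent_iff.1 hS
  refine ⟨rep v, (hrep _).unique (isNearestUnbypassed_self (hrep v).2.1 h), ?_⟩
  ext w
  rw [Set.mem_ofPred_eq, h.reachable_withoutBridges_iff hrep, eq_comm]
  rfl

theorem isRepresentative_iff {rep : V → V} (hrep : ∀ v, IsNearestUnbypassed α c (rep v) v)
    {r : V} (hr : rep r = r) (t : V) : IsRepresentative c t {v | rep v = r} ↔ t = r := by
  constructor
  · rintro ⟨ht, hall⟩
    exact h.eq_of_isAncestor (hall r hr) (ht ▸ (hrep t).1)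
  · rintro rfl
    exact ⟨hr, fun v hv => hv ▸ (hrep v).1⟩

end IsDFSTree

end Connectivity

end SelfStab

theorem mainTheorem2 {V : Type*} [Fintype V] [DecidableEq V] (G : SimpleGraph V)
    [DecidableRel G.Adj] (hG : G.Connected) (root : V) (α : SelfStab.PortNumbering G)
    (N : ℕ) (hN : Fintype.card V ≤ N) (e : ℕ → SelfStab.Config G)
    (he : SelfStab.IsFairExecution α root N e) :
    ∃ T : ℕ, ∀ t ≥ T,
      -- the path fields describe the first depth-first search tree
      (∀ v, IsLeast (SelfStab.simplePathWords α root v) (SelfStab.pathOf (e t) v)) ∧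
      (∀ v, v ≠ root → ∃! u, SelfStab.IsParentLink α (e t) v u) ∧
      -- every link is of one of the four types
      (∀ u v, G.Adj u v →
        SelfStab.IsParentLink α (e t) u v ∨ SelfStab.IsChildLink α (e t) u v ∨
          SelfStab.IsOutgoing α (e t) u v ∨ SelfStab.IsIncoming α (e t) u v) ∧
      -- the count fields hold the numbers of bypassing non-tree edges
      (∀ v, SelfStab.countOf (e t) v = ((SelfStab.bypassing α (e t) v).ncard : ℤ)) ∧
      -- bridges
      (∀ u v, G.Adj u v →
        (G.IsBridge s(u, v) ↔
          (SelfStab.IsChildLink α (e t) u v ∧ SelfStab.countOf (e t) v = 0) ∨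
          (SelfStab.IsParentLink α (e t) u v ∧ SelfStab.countOf (e t) u = 0))) ∧
      -- articulation points
      (∀ v, v ≠ root →
        (SelfStab.IsArticulationPoint G v ↔
          ∃ u, SelfStab.IsChildLink α (e t) v u ∧
            SelfStab.countOf (e t) u = (SelfStab.incomingFrom α (e t) u v : ℤ))) ∧
      (SelfStab.IsArticulationPoint G root ↔
        ∃ u w, u ≠ w ∧ SelfStab.IsChildLink α (e t) root u ∧
          SelfStab.IsChildLink α (e t) root w) ∧
      -- bridge-connected components and their representative nodes
      (∀ u v, SelfStab.bccOf (e t) u = SelfStab.bccOf (e t) v ↔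
        ∃ S, SelfStab.IsBridgeConnectedComponent G S ∧ u ∈ S ∧ v ∈ S) ∧
      (∀ S, SelfStab.IsBridgeConnectedComponent G S →
        ∃! r, SelfStab.IsRepresentative (e t) r S) ∧
      (∀ S r, SelfStab.IsBridgeConnectedComponent G S → r ∈ S →
        (SelfStab.IsRepresentative (e t) r S ↔ SelfStab.countOf (e t) r = 0)) ∧
      (∀ S r, SelfStab.IsBridgeConnectedComponent G S → SelfStab.IsRepresentative (e t) r S →
        S = {v | SelfStab.bccOf (e t) v = SelfStab.pathOf (e t) r}) := by
  open SelfStab in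
  obtain ⟨σ, hstep, hfair⟩ := he
  have hrun : IsScheduledBy α root N e σ := ⟨hstep, hfair⟩
  have hdeg : ∀ i ≠ root, 0 < G.degree i := fun i hi =>
    haveI : Nontrivial V := ⟨i, root, hi⟩
    hG.preconnected.degree_pos_of_nontrivial i
  obtain ⟨val, hval, hpath⟩ := hrun.exists_isDFSTree hG hN
  -- a configuration with stable path fields, relative to which the tree is described
  obtain ⟨t₀, ht₀⟩ := hpath.exists
  have hc : IsDFSTree α root (pathOf (e t₀)) := ht₀ ▸ hval
  have hpath₀ : ∀ᶠ t in Filter.atTop, pathOf (e t) = pathOf (e t₀) :=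
    hpath.mono fun t ht => ht.trans ht₀.symm
  choose rep hrep hbcc using hrun.exists_eventually_bccOf hdeg hc hpath₀
  have hcount := hrun.eventually_countOf hdeg hc hpath₀
  obtain ⟨T, hT⟩ := Filter.eventually_atTop.1
    (hpath₀.and ((Filter.eventually_all.2 hcount).and (Filter.eventually_all.2 hbcc)))
  refine ⟨T, fun t ht => ?_⟩
  obtain ⟨hp, hcnt, hb⟩ := hT t ht
  -- all notions but those that refer to the counts depend on the path fields only
  have hbyp : ∀ v, bypassing α (e t) v = bypassing α (e t₀) v := fun v => by
    simp only [bypassing, IsOutgoing, IsAncestor, IsParentLink, hp]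
  replace hcnt : ∀ v, countOf (e t) v = ((bypassing α (e t) v).ncard : ℤ) := fun v => by
    rw [hcnt v, hbyp v]
  replace hrep : ∀ v, IsNearestUnbypassed α (e t) (rep v) v := fun v => by
    simpa only [IsNearestUnbypassed, IsAncestor, hbyp, hp] using hrep v
  rw [← hp] at hc
  replace hb : ∀ v, bccOf (e t) v = pathOf (e t) (rep v) := fun v => by rw [hb v, hp]
  have hzero : ∀ v, countOf (e t) v = 0 ↔ bypassing α (e t) v = ∅ := fun v => by
    rw [hcnt v, Nat.cast_eq_zero, Set.ncard_eq_zero]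
  refine ⟨hc.isLeast_simplePathWords, fun v hv => ?_, fun u v => hc.link_cases, hcnt,
    fun u v huv => ?_, fun v hv => ?_, ?_, fun u v => ?_, fun S hS => ?_, fun S r hS hr => ?_,
    fun S r hS hr => ?_⟩
  · obtain ⟨p, hp⟩ := hc.exists_isParentLink hv
    exact ⟨p, hp, fun q hq => hc.isParentLink_unique hq hp⟩
  · rw [hc.isBridge_iff huv, hzero, hzero]
  · rw [hc.isArticulationPoint_iff hv]
    refine exists_congr fun u => ?_
    rw [isChildLink_iff_isParentLink]
    refine and_congr_right fun hu => ?_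
    rw [hcnt, Nat.cast_inj, hc.ncard_bypassing_eq_incomingFrom_iff hu]
  · simp only [isChildLink_iff_isParentLink]
    exact hc.isArticulationPoint_root_iff
  · rw [hb, hb, hc.pathOf_injective.eq_iff]
    constructor
    · exact fun huv => ⟨_, isBridgeConnectedComponent_iff.2 ⟨u, rfl⟩, .refl u,
        (hc.reachable_withoutBridges_iff hrep).2 huv⟩
    · rintro ⟨S, hS, hu, hv⟩
      obtain ⟨r, -, rfl⟩ := hc.exists_eq_fiber hrep hS
      exact hu.trans hv.symm
  · obtain ⟨r, hr, rfl⟩ := hc.exists_eq_fiber hrep hS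
    simp only [hc.isRepresentative_iff hrep hr]
    exact ⟨r, rfl, fun _ h => h⟩
  · obtain ⟨s, hs, rfl⟩ := hc.exists_eq_fiber hrep hS
    rw [hc.isRepresentative_iff hrep hs, hzero]
    constructor
    · rintro rfl
      exact hs ▸ (hrep r).2.1
    · intro h0
      exact ((hrep r).unique (isNearestUnbypassed_self h0 hc)).symm.trans hr
  · obtain ⟨s, hs, rfl⟩ := hc.exists_eq_fiber hrep hS
    obtain rfl := (hc.isRepresentative_iff hrep hs r).1 hr
    ext v
    simp only [Set.mem_ofPred_eq, hb, hc.pathOf_injective.eq_iff]
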